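/- Let $H$ be a definite quaternion algebra over $\mathbb{Q}$, i.e. $H=\mathbb{Q}\langle i,j\rangle$ with $i^2=\alpha$, $j^2=\beta$, $ij=-ji$, where $\alpha,\beta\in\mathbb{Q}$ are negative. Let $N$ and $\mathrm{Tr}$ be its reduced norm and reduced trace. For a ($\mathbb{Z}$-)lattice $\mathfrak a\subset H$ of full rank put $N\mathfrak a=\gcd\{N x: x\in\mathfrak a\}$ (the positive generator of the subgroup of $\mathbb{Q}$ generated by these numbers); let $\mathrm{disc}(\mathfrak a)$ be the positive square root of the determinant of the quadratic form $x\mapsto Nx/N\mathfrak a$ on $\mathfrak a$ (the determinant of the Gram matrix of the polar form $Q(x+y)-Q(x)-Q(y)$), and, for a prime $p$, $\mathfrak a_p=\mathfrak a\otimes\mathbb{Z}_p\subset H_p=H\otimes\mathbb{Q}_p$. Let $O\subset H$ be an order (a subring that is a lattice of full rank); $\mathrm{disc}(O)$ is its reduced discriminant. A left $O$-ideal is a lattice $\mathfrak a\subset H$ such that for every prime $p$ there is $x_p\in H_p^\times$ with $\mathfrak a_p=O_p x_p$. Left $O$-ideals $\mathfrak a,\mathfrak b$ are in the same class if $\mathfrak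 a=\mathfrak b x$ for some $x\in H^\times$; write $[\mathfrak a]$ for the class of $\mathfrak a$. There are finitely many classes. Let $M(O)$ be the free $\mathbb{Z}$-module on the set of classes and $M_{\mathbb R}(O)=M(O)\otimes\mathbb{R}$, with the height pairing, the bilinear form given by $$\langle[\mathfrak a],[\mathfrak b]\rangle=\tfrac12\,\#\{x\in H^\times:\mathfrak a x=\mathfrak b\}.$$ For $m\ge 1$ let $T_m(\mathfrak a)$ be the set of left $O$-ideals $\mathfrak b\subseteq\mathfrak a$ with $N\mathfrak b=m\,N\mathfrak a$. The Hecke operator $t_m:M(O)\to M(O)$ is the linear map with $t_m[\mathfrak a]=\sum_{\mathfrak b\in T_m(\mathfrak a)}[\mathfrak b]$, extended $\mathbb{R}$-linearly to $M_{\mathbb R}(O)$; moreover $t_0:M_{\mathbb R}(O)\to M_{\mathbb R}(O)$ is the linear map with $t_0[\mathfrak a]=\tfrac12\sum_{[\mathfrak c]}\frac{1}{\langle[\mathfrak c],[\mathfrak c]\rangle}[\mathfrak c]$, the sum being over all classes. Then the sets $T_m(\mathfrak a)$, $m\ge1$, are finite, and: 1. $t_m$ is self-adjoint for the height pairing: $\langle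 t_m v,w\rangle=\langle v,t_m w\rangle$ for all $v,w\in M(O)$ if $m\ge 1$, and for all $v,w\in M_{\mathbb R}(O)$ if $m\ge 0$. 2. If $\gcd(m,m')=1$, then $t_{mm'}=t_m t_{m'}$, on $M(O)$ if $m,m'\ge 1$, and on $M_{\mathbb R}(O)$ if $m,m'\ge 0$. 3. If $p$ is a prime with $p\nmid\mathrm{disc}(O)$, then $t_{p^{k+2}}=t_{p^{k+1}}t_p-p\,t_{p^k}$ on $M(O)$ for every integer $k\ge 0$. -/

import Mathlib

open scoped Quaternion

noncomputable section

namespace QuatHecke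

/-! ### Reduced norm and trace -/

section Norm

variable {R : Type*} [CommRing R] {α β : R}

/-- Reduced norm `x * conj x` of the quaternion algebra with `i ^ 2 = α`, `j ^ 2 = β`, `ij = -ji`. -/
def nrd (x : ℍ[R,α,β]) : R := (x * star x).re

/-- Reduced trace `x + conj x`. -/
def trd (x : ℍ[R,α,β]) : R := (x + star x).re

theorem nrd_mul (x y : ℍ[R,α,β]) : nrd (x * y) = nrd x * nrd y := by
  simp only [nrd, QuaternionAlgebra.re_mul, QuaternionAlgebra.imI_mul, QuaternionAlgebra.imJ_mul,
    QuaternionAlgebra.imK_mul, QuaternionAlgebra.re_star, QuaternionAlgebra.imI_star,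
    QuaternionAlgebra.imJ_star, QuaternionAlgebra.imK_star]
  ring

theorem nrd_one : nrd (1 : ℍ[R,α,β]) = 1 := by
  simp [nrd]

theorem mul_star_eq (x : ℍ[R,α,β]) : x * star x = algebraMap R ℍ[R,α,β] (nrd x) := by
  rw [QuaternionAlgebra.mul_star_eq_coe]; rfl

theorem add_star_eq (x : ℍ[R,α,β]) : x + star x = algebraMap R ℍ[R,α,β] (trd x) := by
  ext <;> simp [trd, QuaternionAlgebra.coe_algebraMap]

end Norm

variable {α β : ℚ}

theorem nrd_unit_ne_zero (x : (ℍ[ℚ,α,β])ˣ) : nrd (x : ℍ[ℚ,α,β]) ≠ 0 := by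
  intro h
  have h1 : nrd ((x : ℍ[ℚ,α,β]) * ((x⁻¹ : (ℍ[ℚ,α,β])ˣ) : ℍ[ℚ,α,β])) = 1 := by
    rw [Units.mul_inv, nrd_one]
  rw [nrd_mul, h, zero_mul] at h1
  exact zero_ne_one h1

/-! ### Norm and discriminant of a lattice, orders -/

/-- `g` is the greatest common divisor of the set `S` of rational numbers: the non-negative
generator of the subgroup of `ℚ` generated by `S`. -/
def IsGCD (S : Set ℚ) (g : ℚ) : Prop :=
  0 ≤ g ∧ Submodule.span ℤ S = Submodule.span ℤ {g}

open Classical in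
/-- The greatest common divisor of a set of rational numbers (`0` if there is none). -/
def ratGCD (S : Set ℚ) : ℚ :=
  if h : ∃ g, IsGCD S g then h.choose else 0

/-- The norm of a lattice: the gcd of the reduced norms of its elements. -/
def latticeNorm (L : Submodule ℤ ℍ[ℚ,α,β]) : ℚ :=
  ratGCD {r | ∃ x ∈ L, r = nrd x}

/-- The normalized quadratic form `nrd x / latticeNorm L` of a lattice. -/
def normForm (L : Submodule ℤ ℍ[ℚ,α,β]) (x : ℍ[ℚ,α,β]) : ℚ :=
  nrd x / latticeNorm L

/-- The determinant of the normalized form of a lattice: the determinant of the Gram matrix of the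
polar form `Q (x + y) - Q x - Q y` in a `ℤ`-basis (all `ℤ`-bases give the same value). -/
def gramDet (L : Submodule ℤ ℍ[ℚ,α,β]) [L.IsLattice ℚ] : ℚ :=
  Matrix.det (Matrix.of fun i j : Module.Free.ChooseBasisIndex ℤ L =>
    QuadraticMap.polar (normForm L) (Module.Free.chooseBasis ℤ L i : ℍ[ℚ,α,β])
      (Module.Free.chooseBasis ℤ L j : ℍ[ℚ,α,β]))

/-- `disc L`: the positive square root of the determinant of the normalized form, which is the
square of a positive integer. For an order, this is its reduced discriminant. -/
def disc (L : Submodule ℤ ℍ[ℚ,α,β]) [L.IsLattice ℚ] : ℕ :=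
  Nat.sqrt (gramDet L).num.natAbs

/-- The additive group of a subring, as a `ℤ`-submodule. -/
abbrev toLat (O : Subring ℍ[ℚ,α,β]) : Submodule ℤ ℍ[ℚ,α,β] :=
  AddSubgroup.toIntSubmodule O.toAddSubgroup

/-- An order: a subring that is a lattice. -/
class IsOrder (O : Subring ℍ[ℚ,α,β]) : Prop where
  isLattice : (toLat O).IsLattice ℚ

instance (O : Subring ℍ[ℚ,α,β]) [h : IsOrder O] : (toLat O).IsLattice ℚ := h.isLattice

/-! ### Localization and ideals -/

/-- The canonical map from `H` to `H_p = H ⊗ ℚ_p`. -/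
def toLocal (p : ℕ) [Fact p.Prime] (x : ℍ[ℚ,α,β]) : ℍ[ℚ_[p],(α : ℚ_[p]),(β : ℚ_[p])] :=
  ⟨x.re, x.imI, x.imJ, x.imK⟩

theorem toLocal_mul (p : ℕ) [Fact p.Prime] (x y : ℍ[ℚ,α,β]) :
    toLocal p (x * y) = toLocal p x * toLocal p y := by
  ext <;> simp [toLocal]

theorem toLocal_one (p : ℕ) [Fact p.Prime] : toLocal p (1 : ℍ[ℚ,α,β]) = 1 := by
  ext <;> simp [toLocal]

/-- The image in `H_p` of an invertible element of `H`. -/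
def toLocalUnit (p : ℕ) [Fact p.Prime] (x : (ℍ[ℚ,α,β])ˣ) :
    (ℍ[ℚ_[p],(α : ℚ_[p]),(β : ℚ_[p])])ˣ where
  val := toLocal p x
  inv := toLocal p ((x⁻¹ : (ℍ[ℚ,α,β])ˣ) : ℍ[ℚ,α,β])
  val_inv := by rw [← toLocal_mul, Units.mul_inv, toLocal_one]
  inv_val := by rw [← toLocal_mul, Units.inv_mul, toLocal_one]

/-- The localization `L_p = L ⊗ ℤ_p`, as the `ℤ_p`-span of `L` in `H_p`. -/
def localize (p : ℕ) [Fact p.Prime] (L : Submodule ℤ ℍ[ℚ,α,β]) :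
    Submodule ℤ_[p] ℍ[ℚ_[p],(α : ℚ_[p]),(β : ℚ_[p])] :=
  Submodule.span ℤ_[p] (toLocal p '' L)

/-- The lattice `L x`. -/
def mulRight (L : Submodule ℤ ℍ[ℚ,α,β]) (x : ℍ[ℚ,α,β]) : Submodule ℤ ℍ[ℚ,α,β] :=
  L.map (AddMonoidHom.mulRight x).toIntLinearMap

/-- Left `O`-ideals: lattices `L` such that for every prime `p` there is an invertible `x_p` in
`H_p` with `L_p = O_p x_p`. -/
structure IsLeftIdeal (O : Subring ℍ[ℚ,α,β]) (L : Submodule ℤ ℍ[ℚ,α,β]) : Prop where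
  isLattice : L.IsLattice ℚ
  locallyPrincipal : ∀ (p : ℕ) [Fact p.Prime], ∃ x : (ℍ[ℚ_[p],(α : ℚ_[p]),(β : ℚ_[p])])ˣ,
    (localize p L : Set ℍ[ℚ_[p],(α : ℚ_[p]),(β : ℚ_[p])]) =
      (fun y => y * (x : ℍ[ℚ_[p],(α : ℚ_[p]),(β : ℚ_[p])])) '' (localize p (toLat O))

/-- The set of left `O`-ideals. -/
abbrev LeftIdeal (O : Subring ℍ[ℚ,α,β]) : Type := {L : Submodule ℤ ℍ[ℚ,α,β] // IsLeftIdeal O L}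

theorem mem_mulRight {L : Submodule ℤ ℍ[ℚ,α,β]} {x y : ℍ[ℚ,α,β]} :
    y ∈ mulRight L x ↔ ∃ z ∈ L, z * x = y := by
  simp [mulRight, Submodule.mem_map]

theorem mulRight_one (L : Submodule ℤ ℍ[ℚ,α,β]) : mulRight L 1 = L := by
  ext y; simp [mem_mulRight]

theorem mulRight_mulRight (L : Submodule ℤ ℍ[ℚ,α,β]) (x y : ℍ[ℚ,α,β]) :
    mulRight (mulRight L x) y = mulRight L (x * y) := by
  ext z; simp [mem_mulRight, mul_assoc]

theorem mulRight_unit_inv (L : Submodule ℤ ℍ[ℚ,α,β]) (x : (ℍ[ℚ,α,β])ˣ) :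
    mulRight (mulRight L x) ((x⁻¹ : (ℍ[ℚ,α,β])ˣ) : ℍ[ℚ,α,β]) = L := by
  rw [mulRight_mulRight, Units.mul_inv, mulRight_one]

theorem mulRight_inv_unit (L : Submodule ℤ ℍ[ℚ,α,β]) (x : (ℍ[ℚ,α,β])ˣ) :
    mulRight (mulRight L ((x⁻¹ : (ℍ[ℚ,α,β])ˣ) : ℍ[ℚ,α,β])) x = L := by
  rw [mulRight_mulRight, Units.inv_mul, mulRight_one]

theorem mulRight_mono {L M : Submodule ℤ ℍ[ℚ,α,β]} (h : L ≤ M) (x : ℍ[ℚ,α,β]) :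
    mulRight L x ≤ mulRight M x :=
  Submodule.map_mono h

theorem localize_mulRight (p : ℕ) [Fact p.Prime] (L : Submodule ℤ ℍ[ℚ,α,β]) (x : ℍ[ℚ,α,β]) :
    (localize p (mulRight L x) : Set ℍ[ℚ_[p],(α : ℚ_[p]),(β : ℚ_[p])]) =
      (fun y => y * toLocal p x) '' (localize p L) := by
  have h : localize p (mulRight L x) =
      (localize p L).map (LinearMap.mulRight ℤ_[p] (toLocal p x)) := by
    rw [localize, localize, Submodule.map_span]
    congr 1
    ext y
    constructor
    · rintro ⟨_, hw, rfl⟩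
      obtain ⟨z, hz, rfl⟩ := mem_mulRight.1 hw
      exact ⟨toLocal p z, ⟨z, hz, rfl⟩, (toLocal_mul p z x).symm⟩
    · rintro ⟨_, ⟨z, hz, rfl⟩, rfl⟩
      exact ⟨z * x, mem_mulRight.2 ⟨z, hz, rfl⟩, toLocal_mul p z x⟩
  rw [h]
  ext y
  simp

theorem isLattice_mulRight {L : Submodule ℤ ℍ[ℚ,α,β]} (h : L.IsLattice ℚ) (x : (ℍ[ℚ,α,β])ˣ) :
    (mulRight L x).IsLattice ℚ := by
  refine ⟨h.fg.map _, ?_⟩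
  rw [eq_top_iff]
  rintro y -
  have hy : y * ((x⁻¹ : (ℍ[ℚ,α,β])ˣ) : ℍ[ℚ,α,β]) ∈
      Submodule.span ℚ (L : Set ℍ[ℚ,α,β]) := by
    rw [h.span_eq_top]; trivial
  have := Submodule.mem_map_of_mem (f := LinearMap.mulRight ℚ (x : ℍ[ℚ,α,β])) hy
  rw [Submodule.map_span] at this
  simp only [LinearMap.mulRight_apply, mul_assoc, Units.inv_mul, mul_one] at this
  refine Submodule.span_mono ?_ this
  rintro _ ⟨z, hz, rfl⟩
  exact mem_mulRight.2 ⟨z, hz, rfl⟩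

theorem isLeftIdeal_mulRight {O : Subring ℍ[ℚ,α,β]} {L : Submodule ℤ ℍ[ℚ,α,β]}
    (h : IsLeftIdeal O L) (x : (ℍ[ℚ,α,β])ˣ) : IsLeftIdeal O (mulRight L x) := by
  refine ⟨isLattice_mulRight h.isLattice x, fun p _ => ?_⟩
  obtain ⟨y, hy⟩ := h.locallyPrincipal p
  refine ⟨y * toLocalUnit p x, ?_⟩
  rw [localize_mulRight, hy, Set.image_image]
  simp [toLocalUnit, mul_assoc]

/-- The left ideal `L x`, for `x` invertible. -/
def LeftIdeal.mul {O : Subring ℍ[ℚ,α,β]} (a : LeftIdeal O) (x : (ℍ[ℚ,α,β])ˣ) : LeftIdeal O :=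
  ⟨mulRight a.1 x, isLeftIdeal_mulRight a.2 x⟩

/-- Left ideals `a`, `b` are in the same class if `a = b x` with `x` invertible. -/
instance idealSetoid (O : Subring ℍ[ℚ,α,β]) : Setoid (LeftIdeal O) where
  r a b := ∃ x : (ℍ[ℚ,α,β])ˣ, a.1 = mulRight b.1 x
  iseqv :=
    { refl := fun a => ⟨1, by rw [Units.val_one, mulRight_one]⟩
      symm := by
        rintro a b ⟨x, hx⟩
        exact ⟨x⁻¹, by rw [hx, mulRight_unit_inv]⟩
      trans := by
        rintro a b c ⟨x, hx⟩ ⟨y, hy⟩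
        exact ⟨y * x, by rw [hx, hy, mulRight_mulRight, Units.val_mul]⟩ }

/-- The set of left `O`-ideal classes. -/
abbrev IdealClass (O : Subring ℍ[ℚ,α,β]) : Type := Quotient (idealSetoid O)

/-- The class of a left ideal. -/
def cls {O : Subring ℍ[ℚ,α,β]} (a : LeftIdeal O) : IdealClass O := Quotient.mk _ a

theorem cls_mul {O : Subring ℍ[ℚ,α,β]} (a : LeftIdeal O) (x : (ℍ[ℚ,α,β])ˣ) :
    cls (a.mul x) = cls a :=
  Quotient.sound ⟨x, rfl⟩

/-! ### Modules and the height pairing -/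

/-- The free `R`-module on the ideal classes: `M(O)` for `R = ℤ`, and `M_ℝ(O)` for `R = ℝ`. -/
abbrev IdealModule (R : Type*) [CommRing R] (O : Subring ℍ[ℚ,α,β]) : Type _ := IdealClass O →₀ R

/-- The inclusion of `M(O)` into `M_ℝ(O)`. -/
def toReal {O : Subring ℍ[ℚ,α,β]} (v : IdealModule ℤ O) : IdealModule ℝ O :=
  v.mapRange (fun n : ℤ => (n : ℝ)) Int.cast_zero

/-- The invertible `x` with `a x = b`. -/
def transporter {O : Subring ℍ[ℚ,α,β]} (a b : LeftIdeal O) : Set (ℍ[ℚ,α,β])ˣ :=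
  {x | mulRight a.1 x = b.1}

/-- The height pairing of two ideal classes: half the number of invertible `x` with `a x = b`. -/
def heightClass {O : Subring ℍ[ℚ,α,β]} : IdealClass O → IdealClass O → ℝ :=
  Quotient.lift₂ (fun a b => (1 / 2 : ℝ) * Nat.card (transporter a b)) (by
    rintro a b a' b' ⟨x, hx⟩ ⟨y, hy⟩
    have : Nat.card (transporter a b) = Nat.card (transporter a' b') := by
      refine Nat.card_congr
        { toFun := fun u => ⟨x * u.1 * y⁻¹, ?_⟩
          invFun := fun u => ⟨x⁻¹ * u.1 * y, ?_⟩
          left_inv := fun u => Subtype.ext (by simp [mul_assoc])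
          right_inv := fun u => Subtype.ext (by simp [mul_assoc]) }
      · have hu : mulRight a.1 u.1 = b.1 := u.2
        change mulRight a'.1 _ = b'.1
        rw [Units.val_mul, Units.val_mul, ← mulRight_mulRight, ← mulRight_mulRight, ← hx, hu, hy,
          mulRight_unit_inv]
      · have hu : mulRight a'.1 u.1 = b'.1 := u.2
        change mulRight a.1 _ = b.1
        rw [Units.val_mul, Units.val_mul, ← mulRight_mulRight, ← mulRight_mulRight, hx,
          mulRight_unit_inv, hu, hy]
    simp only [this])

/-- The height pairing on `M_ℝ(O)`, extended bilinearly. -/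
def height (O : Subring ℍ[ℚ,α,β]) : IdealModule ℝ O →ₗ[ℝ] IdealModule ℝ O →ₗ[ℝ] ℝ :=
  Finsupp.linearCombination ℝ fun c => Finsupp.linearCombination ℝ fun d => heightClass c d

/-- `e₀`, the sum over all classes `c` of the dual vectors `c / ⟨c, c⟩` (the number of classes is
finite). -/
def e₀ (O : Subring ℍ[ℚ,α,β]) : IdealModule ℝ O :=
  ∑ᶠ c : IdealClass O, Finsupp.single c (1 / heightClass c c)

/-! ### Hecke operators -/

/-- `T_m(a)`: the left ideals `b` contained in `a` with `N(b) = m N(a)`. -/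
def heckeSet {O : Subring ℍ[ℚ,α,β]} (m : ℕ) (a : LeftIdeal O) : Set (LeftIdeal O) :=
  {b | b.1 ≤ a.1 ∧ latticeNorm b.1 = m * latticeNorm a.1}

theorem isGCD_smul {S : Set ℚ} {g : ℚ} (h : IsGCD S g) (c : ℚ) :
    IsGCD ((fun r => c * r) '' S) (|c| * g) := by
  refine ⟨mul_nonneg (abs_nonneg c) h.1, ?_⟩
  have h1 : Submodule.span ℤ ((fun r => c * r) '' S) = Submodule.span ℤ {c * g} := by
    have := congrArg (Submodule.map (AddMonoidHom.mulLeft c).toIntLinearMap) h.2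
    rw [Submodule.map_span, Submodule.map_span, Set.image_singleton] at this
    exact this
  rw [h1]
  rcases abs_choice c with hc | hc <;> rw [hc]
  rw [neg_mul, ← Set.neg_singleton, Submodule.span_neg]

theorem isGCD_unique {S : Set ℚ} {g g' : ℚ} (h : IsGCD S g) (h' : IsGCD S g') : g = g' := by
  have e : Submodule.span ℤ {g} = Submodule.span ℤ {g'} := h.2.symm.trans h'.2
  obtain ⟨u, hu⟩ := Submodule.mem_span_singleton.1 (e ▸ Submodule.mem_span_singleton_self g)
  obtain ⟨v, hv⟩ := Submodule.mem_span_singleton.1 (e ▸ Submodule.mem_span_singleton_self g')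
  rw [zsmul_eq_mul] at hu hv
  have key : ∀ {s t : ℚ} {n : ℤ}, 0 ≤ s → 0 ≤ t → (n : ℚ) * s = t → t ≠ 0 → s ≤ t := by
    intro s t n hs ht hn h0
    have hs0 : 0 < s := lt_of_le_of_ne hs (by rintro rfl; simp at hn; exact h0 hn.symm)
    have hn0 : (0 : ℚ) < n := by
      by_contra hneg
      exact h0 (le_antisymm (hn ▸ mul_nonpos_of_nonpos_of_nonneg (not_lt.1 hneg) hs) ht)
    have : (1 : ℚ) ≤ n := by exact_mod_cast hn0
    nlinarith
  by_cases hg : g = 0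
  · rw [hg, mul_zero] at hv; rw [hg, hv]
  by_cases hg' : g' = 0
  · rw [hg', mul_zero] at hu; rw [hg', hu]
  exact le_antisymm (key h.1 h'.1 hv hg') (key h'.1 h.1 hu hg)

theorem ratGCD_eq {S : Set ℚ} {g : ℚ} (h : IsGCD S g) : ratGCD S = g := by
  have hex : ∃ g, IsGCD S g := ⟨g, h⟩
  rw [ratGCD, dif_pos hex]
  exact isGCD_unique hex.choose_spec h

theorem ratGCD_smul (S : Set ℚ) {c : ℚ} (hc : c ≠ 0) :
    ratGCD ((fun r => c * r) '' S) = |c| * ratGCD S := by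
  by_cases h : ∃ g, IsGCD S g
  · obtain ⟨g, hg⟩ := h
    rw [ratGCD_eq hg, ratGCD_eq (isGCD_smul hg c)]
  · have h' : ¬ ∃ g, IsGCD ((fun r => c * r) '' S) g := by
      rintro ⟨g, hg⟩
      apply h
      have := isGCD_smul hg c⁻¹
      simp only [Set.image_image, inv_mul_cancel_left₀ hc, Set.image_id'] at this
      exact ⟨_, this⟩
    rw [ratGCD, ratGCD, dif_neg h, dif_neg h', mul_zero]

theorem latticeNorm_mulRight (L : Submodule ℤ ℍ[ℚ,α,β]) (x : (ℍ[ℚ,α,β])ˣ) :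
    latticeNorm (mulRight L x) = |nrd (x : ℍ[ℚ,α,β])| * latticeNorm L := by
  rw [latticeNorm, latticeNorm, ← ratGCD_smul _ (nrd_unit_ne_zero x)]
  congr 1
  ext r
  constructor
  · rintro ⟨y, hy, rfl⟩
    obtain ⟨z, hz, rfl⟩ := mem_mulRight.1 hy
    exact ⟨nrd z, ⟨z, hz, rfl⟩, by simp only [nrd_mul]; ring⟩
  · rintro ⟨_, ⟨z, hz, rfl⟩, rfl⟩
    exact ⟨z * x, mem_mulRight.2 ⟨z, hz, rfl⟩, by simp only [nrd_mul]; ring⟩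

theorem mul_mem_heckeSet {O : Subring ℍ[ℚ,α,β]} {m : ℕ} {a b : LeftIdeal O}
    (h : b ∈ heckeSet m a) (x : (ℍ[ℚ,α,β])ˣ) : b.mul x ∈ heckeSet m (a.mul x) := by
  refine ⟨mulRight_mono h.1 _, ?_⟩
  change latticeNorm (mulRight b.1 x) = m * latticeNorm (mulRight a.1 x)
  rw [latticeNorm_mulRight, latticeNorm_mulRight, h.2]
  ring

/-- `t_m [a] = ∑_{b ∈ T_m(a)} [b]` (the set `T_m(a)` is finite for `m ≥ 1`). -/
def heckeClass {O : Subring ℍ[ℚ,α,β]} (R : Type*) [CommRing R] (m : ℕ) :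
    IdealClass O → IdealModule R O :=
  Quotient.lift (fun a => ∑ᶠ b : heckeSet m a, Finsupp.single (cls b.1) (1 : R)) (by
    rintro a a' ⟨x, hx⟩
    have ha : a = a'.mul x := Subtype.ext hx
    subst ha
    have h1 : ∀ c : LeftIdeal O, (c.mul x).mul x⁻¹ = c := fun c =>
      Subtype.ext (mulRight_unit_inv c.1 x)
    have h2 : ∀ c : LeftIdeal O, (c.mul x⁻¹).mul x = c := fun c =>
      Subtype.ext (mulRight_inv_unit c.1 x)
    let e : heckeSet m a' ≃ heckeSet m (a'.mul x) :=
      { toFun := fun b => ⟨b.1.mul x, mul_mem_heckeSet b.2 x⟩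
        invFun := fun b => ⟨b.1.mul x⁻¹, by
          have := mul_mem_heckeSet b.2 x⁻¹
          rwa [h1] at this⟩
        left_inv := fun b => Subtype.ext (h1 b.1)
        right_inv := fun b => Subtype.ext (h2 b.1) }
    refine (finsum_eq_of_bijective e e.bijective fun b => ?_).symm
    change _ = Finsupp.single (cls (b.1.mul x)) (1 : R)
    rw [cls_mul])

/-- The Hecke operator `t_m`, `m ≥ 1`, on the free `R`-module on the ideal classes. -/
def hecke (R : Type*) [CommRing R] (O : Subring ℍ[ℚ,α,β]) (m : ℕ) :
    IdealModule R O →ₗ[R] IdealModule R O :=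
  Finsupp.linearCombination R (heckeClass R m)

/-- The operator `t_0`, with `t_0 [a] = e₀ / 2` for all `a`. -/
def heckeZero (O : Subring ℍ[ℚ,α,β]) : IdealModule ℝ O →ₗ[ℝ] IdealModule ℝ O :=
  Finsupp.linearCombination ℝ fun _ => (1 / 2 : ℝ) • e₀ O

/-- The operators `t_m`, `m ≥ 0`, on `M_ℝ(O)`. -/
def heckeReal (O : Subring ℍ[ℚ,α,β]) (m : ℕ) : IdealModule ℝ O →ₗ[ℝ] IdealModule ℝ O :=
  if m = 0 then heckeZero O else hecke ℝ O m

end QuatHecke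

end

/-!
Pairs `x`, `b` with `b` in `T_m(a)` and `b x = c` correspond to pairs `y`, `d` with `d` in `T_m(c)`
and `d y = a`, through `y = m x⁻¹`: if `b` lies in `T_m(a)`, then `m a` lies in `T_m(b)`. This is
the self-adjointness of `t_m`.

The coefficient of `[c]` in `t_m t_{m'} [a]` counts the ideals `b` with `c ⊆ b ⊆ a` and
`N b = m' N a`. For coprime `m`, `m'` the only one is `a ∩ m⁻¹ c`.

For a prime `p ∤ disc O` the order `O / p O` carries a nondegenerate quadratic norm, hence it is a
quaternion algebra over a finite field, that is, the algebra of `2 × 2` matrices. After scaling `a`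
to agree with `O` at `p`, the ideals in `T_p(a)` correspond to the `p + 1` lines in the plane over
the field of `p` elements. An ideal `c` in `T_{p^{k+2}}(a)` thus lies in exactly one `b` in `T_p(a)`
if `c ⊄ p a`, and in all `p + 1` of them if `c ⊆ p a`. The latter `c` are the `p c'` with `c'` in
`T_{p^k}(a)`.
-/

noncomputable section

namespace QuatHecke

section Algebra

variable {R : Type*} [CommRing R] {a b : R}

theorem nrd_eq (x : ℍ[R,a,b]) :
    nrd x = x.re ^ 2 - a * x.imI ^ 2 - b * x.imJ ^ 2 + a * b * x.imK ^ 2 := by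
  simp only [nrd, QuaternionAlgebra.re_mul, QuaternionAlgebra.re_star, QuaternionAlgebra.imI_star,
    QuaternionAlgebra.imJ_star, QuaternionAlgebra.imK_star]
  ring

theorem trd_eq (x : ℍ[R,a,b]) : trd x = 2 * x.re := by
  simp [trd]; ring

theorem nrd_zero : nrd (0 : ℍ[R,a,b]) = 0 := by
  simp [nrd]

theorem nrd_star (x : ℍ[R,a,b]) : nrd (star x) = nrd x := by
  simp [nrd_eq]

theorem trd_star (x : ℍ[R,a,b]) : trd (star x) = trd x := by
  simp [trd_eq]

theorem trd_add (x y : ℍ[R,a,b]) : trd (x + y) = trd x + trd y := by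
  simp [trd_eq, mul_add]

theorem nrd_add (x y : ℍ[R,a,b]) : nrd (x + y) = nrd x + nrd y + trd (x * star y) := by
  simp [nrd_eq, trd_eq]; ring

theorem trd_eq_nrd (x : ℍ[R,a,b]) : trd x = nrd (1 + x) - 1 - nrd x := by
  simp [trd_eq, nrd_eq]; ring

theorem star_mul_eq (x : ℍ[R,a,b]) : star x * x = algebraMap R ℍ[R,a,b] (nrd x) := by
  rw [← nrd_star, ← mul_star_eq, star_star]

theorem star_eq_trd_sub (x : ℍ[R,a,b]) : star x = algebraMap R ℍ[R,a,b] (trd x) - x := by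
  rw [← add_star_eq, add_sub_cancel_left]

theorem nrd_smul {S : Type*} [CommRing S] [Algebra S R] (c : S) (x : ℍ[R,a,b]) :
    nrd (c • x) = algebraMap S R c ^ 2 * nrd x := by
  simp only [nrd_eq, QuaternionAlgebra.re_smul, QuaternionAlgebra.imI_smul,
    QuaternionAlgebra.imJ_smul, QuaternionAlgebra.imK_smul]
  simp only [Algebra.smul_def]
  ring

theorem trd_smul {S : Type*} [CommRing S] [Algebra S R] (c : S) (x : ℍ[R,a,b]) :
    trd (c • x) = algebraMap S R c * trd x := by
  rw [trd_eq, trd_eq, QuaternionAlgebra.re_smul, Algebra.smul_def]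
  ring

theorem isUnit_iff_isUnit_nrd {x : ℍ[R,a,b]} : IsUnit x ↔ IsUnit (nrd x) := by
  constructor
  · rintro ⟨u, rfl⟩
    exact .of_mul_eq_one (nrd (↑u⁻¹ : ℍ[R,a,b])) (by rw [← nrd_mul, u.mul_inv, nrd_one])
  · rintro ⟨c, hc⟩
    refine ⟨⟨x, c⁻¹ • star x, ?_, ?_⟩, rfl⟩
    · rw [mul_smul_comm, mul_star_eq, ← hc, Algebra.algebraMap_eq_smul_one, ← Units.smul_def,
        inv_smul_smul]
    · rw [smul_mul_assoc, star_mul_eq, ← hc, Algebra.algebraMap_eq_smul_one, ← Units.smul_def,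
        inv_smul_smul]

theorem nrd_smul_unit_inv (x : (ℍ[R,a,b])ˣ) :
    nrd (x : ℍ[R,a,b]) • (↑x⁻¹ : ℍ[R,a,b]) = star (x : ℍ[R,a,b]) := by
  rw [Algebra.smul_def, ← star_mul_eq, mul_assoc, x.mul_inv, mul_one]

section Ordered

variable [LinearOrder R] [IsStrictOrderedRing R]

theorem nrd_pos (ha : a < 0) (hb : b < 0) {x : ℍ[R,a,b]} (hx : x ≠ 0) : 0 < nrd x := by
  have hab : 0 < a * b := mul_pos_of_neg_of_neg ha hb
  have hi := mul_nonneg_of_nonpos_of_nonpos ha.le (neg_nonpos.2 (sq_nonneg x.imI))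
  have hj := mul_nonneg_of_nonpos_of_nonpos hb.le (neg_nonpos.2 (sq_nonneg x.imJ))
  have hk := mul_nonneg hab.le (sq_nonneg x.imK)
  have hr := sq_nonneg x.re
  rw [nrd_eq]
  by_contra! hle
  refine hx (QuaternionAlgebra.ext ?_ ?_ ?_ ?_)
  · exact pow_eq_zero_iff two_ne_zero |>.1 (by linarith)
  · exact pow_eq_zero_iff two_ne_zero |>.1
      ((mul_eq_zero_iff_left ha.ne).1 (by linarith : a * x.imI ^ 2 = 0))
  · exact pow_eq_zero_iff two_ne_zero |>.1
      ((mul_eq_zero_iff_left hb.ne).1 (by linarith : b * x.imJ ^ 2 = 0))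
  · exact pow_eq_zero_iff two_ne_zero |>.1
      ((mul_eq_zero_iff_left hab.ne').1 (by linarith : a * b * x.imK ^ 2 = 0))

theorem nrd_nonneg (ha : a < 0) (hb : b < 0) (x : ℍ[R,a,b]) : 0 ≤ nrd x := by
  rcases eq_or_ne x 0 with rfl | hx
  · exact nrd_zero.ge
  · exact (nrd_pos ha hb hx).le

end Ordered

end Algebra

section Rational

variable {α β : ℚ}

theorem nrd_unit_inv (x : (ℍ[ℚ,α,β])ˣ) :
    nrd (↑x⁻¹ : ℍ[ℚ,α,β]) = (nrd (x : ℍ[ℚ,α,β]))⁻¹ :=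
  eq_inv_of_mul_eq_one_left (by rw [← nrd_mul, x.inv_mul, nrd_one])

theorem isUnit_of_ne_zero (hα : α < 0) (hβ : β < 0) {x : ℍ[ℚ,α,β]} (hx : x ≠ 0) : IsUnit x :=
  isUnit_iff_isUnit_nrd.2 (nrd_pos hα hβ hx).ne'.isUnit

theorem mem_mulRight_unit {L : Submodule ℤ ℍ[ℚ,α,β]} {x : (ℍ[ℚ,α,β])ˣ} {y : ℍ[ℚ,α,β]} :
    y ∈ mulRight L x ↔ y * ↑x⁻¹ ∈ L := by
  rw [mem_mulRight]
  constructor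
  · rintro ⟨z, hz, rfl⟩
    rwa [mul_assoc, x.mul_inv, mul_one]
  · intro h
    exact ⟨_, h, by rw [mul_assoc, x.inv_mul, mul_one]⟩

/-- A nonzero integer as a unit of the quaternion algebra. -/
def intUnit (m : ℤ) (hm : m ≠ 0) : (ℍ[ℚ,α,β])ˣ :=
  Units.map (algebraMap ℚ ℍ[ℚ,α,β]).toMonoidHom (Units.mk0 (m : ℚ) (Int.cast_ne_zero.2 hm))

theorem mul_intUnit (m : ℤ) (hm : m ≠ 0) (y : ℍ[ℚ,α,β]) :
    y * (intUnit m hm : (ℍ[ℚ,α,β])ˣ) = m • y := by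
  change y * algebraMap ℚ ℍ[ℚ,α,β] m = m • y
  rw [map_intCast, ← Int.cast_comm, zsmul_eq_mul]

end Rational

/-! ### Finitely generated groups of rational numbers -/

theorem exists_eq_span_singleton_of_fg {J : Submodule ℤ ℚ} (hJ : J.FG) :
    ∃ g : ℚ, 0 ≤ g ∧ J = Submodule.span ℤ {g} := by
  let I : FractionalIdeal (nonZeroDivisors ℤ) ℚ := ⟨J, FractionalIdeal.isFractional_of_fg hJ⟩
  obtain ⟨g, hg⟩ := (inferInstance : (I : Submodule ℤ ℚ).IsPrincipal).principal
  refine ⟨|g|, abs_nonneg g, ?_⟩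
  rcases abs_choice g with h | h <;> rw [h]
  · exact hg
  · rw [← Set.neg_singleton, Submodule.span_neg]; exact hg

theorem finite_abs_le_of_fg {J : Submodule ℤ ℚ} (hJ : J.FG) (B : ℚ) :
    {r | r ∈ J ∧ |r| ≤ B}.Finite := by
  obtain ⟨g, hg, rfl⟩ := exists_eq_span_singleton_of_fg hJ
  rcases hg.eq_or_lt with rfl | hg
  · refine (Set.finite_singleton (0 : ℚ)).subset ?_
    rintro r ⟨hr, -⟩
    simpa using hr
  · refine ((Set.finite_Icc (-⌊B / g⌋) ⌊B / g⌋).image fun n : ℤ => n • g).subset ?_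
    rintro r ⟨hr, hB⟩
    obtain ⟨n, rfl⟩ := Submodule.mem_span_singleton.1 hr
    refine ⟨n, abs_le.1 (Int.le_floor.2 ?_), rfl⟩
    rw [zsmul_eq_mul, abs_mul, abs_of_pos hg] at hB
    rw [Int.cast_abs, le_div_iff₀ hg]
    exact hB

theorem abs_le_of_mul_sq_le {K : Type*} [Field K] [LinearOrder K] [IsStrictOrderedRing K]
    {c r C : K} (hc : 0 < c) (h : c * r ^ 2 ≤ C) : |r| ≤ C / c + 1 := by
  have hr : |r| ^ 2 ≤ C / c := by rwa [sq_abs, le_div_iff₀ hc, mul_comm]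
  nlinarith [sq_nonneg (|r| - 1)]

theorem exists_ne_zero_smul_mem {V : Type*} [AddCommGroup V] [Module ℚ V] (L : Submodule ℤ V)
    [hL : L.IsLattice ℚ] (y : V) : ∃ n : ℤ, n ≠ 0 ∧ n • y ∈ L := by
  obtain ⟨⟨n, hn⟩, hy⟩ := multiple_mem_span_of_mem_localization_span (nonZeroDivisors ℤ) ℚ
    (L : Set V) y (hL.span_eq_top ▸ trivial)
  exact ⟨n, nonZeroDivisors.ne_zero hn, by rwa [Submodule.span_eq] at hy⟩

/-! ### Norms of lattices -/

section LatticeNorm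

variable {α β : ℚ}

/-- The integer bilinear form `re (x ȳ)`, whose diagonal is the reduced norm. -/
def normPairing (α β : ℚ) : ℍ[ℚ,α,β] →ₗ[ℤ] ℍ[ℚ,α,β] →ₗ[ℤ] ℚ :=
  LinearMap.mk₂ ℤ (fun x y => (x * star y).re)
    (fun x y z => by rw [add_mul, QuaternionAlgebra.re_add])
    (fun n x y => by rw [smul_mul_assoc, QuaternionAlgebra.re_smul])
    (fun x y z => by rw [star_add, mul_add, QuaternionAlgebra.re_add])
    (fun n x y => by rw [star_zsmul, mul_smul_comm, QuaternionAlgebra.re_smul])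

theorem fg_span_nrd {L : Submodule ℤ ℍ[ℚ,α,β]} (hL : L.FG) :
    (Submodule.span ℤ (nrd '' (L : Set ℍ[ℚ,α,β]))).FG := by
  refine (hL.map₂ (normPairing α β) hL).of_le (Submodule.span_le.2 ?_)
  rintro _ ⟨x, hx, rfl⟩
  exact Submodule.apply_mem_map₂ (normPairing α β) hx hx

theorem isGCD_latticeNorm {L : Submodule ℤ ℍ[ℚ,α,β]} (hL : L.FG) :
    IsGCD (nrd '' (L : Set ℍ[ℚ,α,β])) (latticeNorm L) := by
  obtain ⟨g, hg⟩ := exists_eq_span_singleton_of_fg (fg_span_nrd hL)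
  have hnorm : latticeNorm L = ratGCD (nrd '' (L : Set ℍ[ℚ,α,β])) :=
    congrArg ratGCD (Set.ext fun r => exists_congr fun x => and_congr_right fun _ => eq_comm)
  rwa [hnorm, ratGCD_eq hg]

theorem exists_nrd_eq_mul_latticeNorm {L : Submodule ℤ ℍ[ℚ,α,β]} (hL : L.FG) {x : ℍ[ℚ,α,β]}
    (hx : x ∈ L) : ∃ n : ℤ, nrd x = n * latticeNorm L := by
  have h : nrd x ∈ Submodule.span ℤ {latticeNorm L} :=
    (isGCD_latticeNorm hL).2 ▸ Submodule.subset_span ⟨x, hx, rfl⟩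
  obtain ⟨n, hn⟩ := Submodule.mem_span_singleton.1 h
  exact ⟨n, by rw [← hn, zsmul_eq_mul]⟩

theorem latticeNorm_pos (L : Submodule ℤ ℍ[ℚ,α,β]) [hL : L.IsLattice ℚ] : 0 < latticeNorm L := by
  refine (isGCD_latticeNorm hL.fg).1.lt_of_ne fun h0 => ?_
  obtain ⟨n, hn, hmem⟩ := exists_ne_zero_smul_mem L (1 : ℍ[ℚ,α,β])
  obtain ⟨m, hm⟩ := exists_nrd_eq_mul_latticeNorm hL.fg hmem
  rw [← h0, mul_zero, nrd_smul, nrd_one, mul_one, eq_intCast] at hm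
  exact hn (Int.cast_eq_zero.1 (pow_eq_zero_iff two_ne_zero |>.1 hm))

theorem finite_nrd_le (hα : α < 0) (hβ : β < 0) {L : Submodule ℤ ℍ[ℚ,α,β]} (hL : L.FG) (C : ℚ) :
    {x | x ∈ L ∧ nrd x ≤ C}.Finite := by
  have hαβ : 0 < α * β := mul_pos_of_neg_of_neg hα hβ
  have finite_coord (f : ℍ[ℚ,α,β] →ₗ[ℚ] ℚ) (B : ℚ) :=
    finite_abs_le_of_fg (hL.map (f.restrictScalars ℤ)) B
  refine Set.Finite.subset (Set.Finite.preimage (QuaternionAlgebra.equivProd α 0 β).injective.injOn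
    ((finite_coord (QuaternionAlgebra.reₗ α 0 β) (C / 1 + 1)).prod
      ((finite_coord (QuaternionAlgebra.imIₗ α 0 β) (C / -α + 1)).prod
        ((finite_coord (QuaternionAlgebra.imJₗ α 0 β) (C / -β + 1)).prod
          (finite_coord (QuaternionAlgebra.imKₗ α 0 β) (C / (α * β) + 1)))))) ?_
  rintro x ⟨hx, hC⟩
  have hr := mul_nonneg zero_le_one (sq_nonneg x.re)
  have hi := mul_nonneg (neg_pos.2 hα).le (sq_nonneg x.imI)
  have hj := mul_nonneg (neg_pos.2 hβ).le (sq_nonneg x.imJ)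
  have hk := mul_nonneg hαβ.le (sq_nonneg x.imK)
  rw [nrd_eq] at hC
  exact ⟨⟨⟨x, hx, rfl⟩, abs_le_of_mul_sq_le one_pos (by linarith : 1 * x.re ^ 2 ≤ C)⟩,
    ⟨⟨x, hx, rfl⟩, abs_le_of_mul_sq_le (neg_pos.2 hα) (by linarith : -α * x.imI ^ 2 ≤ C)⟩,
    ⟨⟨x, hx, rfl⟩, abs_le_of_mul_sq_le (neg_pos.2 hβ) (by linarith : -β * x.imJ ^ 2 ≤ C)⟩,
    ⟨⟨x, hx, rfl⟩, abs_le_of_mul_sq_le hαβ (by linarith : α * β * x.imK ^ 2 ≤ C)⟩⟩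

end LatticeNorm

section Order

variable {α β : ℚ} {O : Subring ℍ[ℚ,α,β]} [hO : IsOrder O]

theorem exists_nrd_eq_intCast {x : ℍ[ℚ,α,β]} (hx : x ∈ O) : ∃ n : ℤ, nrd x = n := by
  let norms : Submonoid ℚ := O.toSubmonoid.map (⟨⟨nrd, nrd_one⟩, nrd_mul⟩ : ℍ[ℚ,α,β] →* ℚ)
  have hspan : (Algebra.adjoin ℤ (norms : Set ℚ)).toSubmodule =
      Submodule.span ℤ (nrd '' (toLat O : Set ℍ[ℚ,α,β])) := by
    rw [Algebra.adjoin_eq_span, Submonoid.closure_eq]; rfl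
  have h_integral : IsIntegral ℤ (nrd x) := .of_mem_of_fg (Algebra.adjoin ℤ (norms : Set ℚ))
    (hspan ▸ fg_span_nrd hO.isLattice.fg) _ (Algebra.subset_adjoin ⟨x, hx, rfl⟩)
  obtain ⟨n, hn⟩ := IsIntegrallyClosed.isIntegral_iff.1 h_integral
  exact ⟨n, hn.symm⟩

theorem exists_trd_eq_intCast {x : ℍ[ℚ,α,β]} (hx : x ∈ O) : ∃ n : ℤ, trd x = n := by
  obtain ⟨m, hm⟩ := exists_nrd_eq_intCast hx
  obtain ⟨n, hn⟩ := exists_nrd_eq_intCast (O.add_mem O.one_mem hx)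
  exact ⟨n - 1 - m, by rw [trd_eq_nrd, hm, hn]; push_cast; rfl⟩

theorem star_mem_order {x : ℍ[ℚ,α,β]} (hx : x ∈ O) : star x ∈ O := by
  obtain ⟨n, hn⟩ := exists_trd_eq_intCast hx
  rw [star_eq_trd_sub, hn, map_intCast]
  exact O.sub_mem (intCast_mem O n) hx

theorem latticeNorm_order : latticeNorm (toLat O) = 1 := by
  refine isGCD_unique (isGCD_latticeNorm hO.isLattice.fg) ⟨zero_le_one, le_antisymm
    (Submodule.span_le.2 ?_) (Submodule.span_mono ?_)⟩
  · rintro _ ⟨x, hx, rfl⟩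
    obtain ⟨n, hn⟩ := exists_nrd_eq_intCast (O := O) hx
    exact Submodule.mem_span_singleton.2 ⟨n, by rw [hn, zsmul_eq_mul, mul_one]⟩
  · rintro _ rfl
    exact ⟨1, O.one_mem, nrd_one⟩

end Order

/-! ### Localization at a prime -/

section Localization

variable {V : Type*} [AddCommGroup V]

theorem exists_common_smul_mem {R W : Type*} [CommRing R] [AddCommGroup W] [Module R W]
    (S : Submonoid R) {L M : Submodule R W} (hL : L.FG)
    (h : ∀ z ∈ L, ∃ s ∈ S, s • z ∈ M) : ∃ s ∈ S, ∀ z ∈ L, s • z ∈ M := by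
  obtain ⟨G, rfl⟩ := hL
  choose! s hsS hsM using fun z (hz : z ∈ G) => h z (Submodule.subset_span hz)
  refine ⟨∏ g ∈ G, s g, S.prod_mem hsS, fun z hz => ?_⟩
  suffices hle : Submodule.span R (G : Set W) ≤ M.comap (LinearMap.lsmul R W (∏ g ∈ G, s g)) from
    hle hz
  refine Submodule.span_le.2 fun g hg => ?_
  obtain ⟨c, hc⟩ := Finset.dvd_prod_of_mem s hg
  rw [SetLike.mem_coe, Submodule.mem_comap, LinearMap.lsmul_apply, hc, mul_comm, mul_smul]
  exact M.smul_mem c (hsM g hg)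

/-- The integers prime to `p`. -/
def primeTo (p : ℕ) [hp : Fact p.Prime] : Submonoid ℤ where
  carrier := {s | ¬ (p : ℤ) ∣ s}
  mul_mem' hs ht h := ((Nat.prime_iff_prime_int.1 hp.out).dvd_or_dvd h).elim hs ht
  one_mem' h := (Nat.prime_iff_prime_int.1 hp.out).not_isUnit (isUnit_of_dvd_one h)

/-- The localization `L_(p)` of `L` inside its ambient group: the elements with a multiple in `L` by
an integer prime to `p`. -/
def loc (p : ℕ) [Fact p.Prime] (L : Submodule ℤ V) : Submodule ℤ V where
  carrier := {y | ∃ s ∈ primeTo p, s • y ∈ L}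
  add_mem' := by
    rintro x y ⟨s, hs, hx⟩ ⟨t, ht, hy⟩
    refine ⟨s * t, mul_mem hs ht, ?_⟩
    rw [smul_add]
    refine L.add_mem ?_ ?_
    · rw [mul_comm, mul_smul]; exact L.smul_mem _ hx
    · rw [mul_smul]; exact L.smul_mem _ hy
  zero_mem' := ⟨1, one_mem _, by rw [smul_zero]; exact L.zero_mem⟩
  smul_mem' := by
    rintro n x ⟨s, hs, hx⟩
    exact ⟨s, hs, by rw [smul_comm]; exact L.smul_mem _ hx⟩

section Prime

variable {p : ℕ} [hp : Fact p.Prime] {L M : Submodule ℤ V} {y : V}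

theorem natCast_mem_primeTo_or_of_coprime {m n : ℕ} (h : Nat.Coprime m n) :
    (m : ℤ) ∈ primeTo p ∨ (n : ℤ) ∈ primeTo p := by
  by_contra! hdvd
  simp only [primeTo, Submonoid.mem_mk, Subsemigroup.mem_mk, Set.mem_ofPred_eq, not_not,
    Int.natCast_dvd_natCast] at hdvd
  exact Nat.Prime.not_coprime_iff_dvd.2 ⟨p, hp.out, hdvd⟩ h

theorem mem_loc : y ∈ loc p L ↔ ∃ s ∈ primeTo p, s • y ∈ L := Iff.rfl

theorem le_loc (L : Submodule ℤ V) : L ≤ loc p L := fun y hy =>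
  ⟨1, one_mem _, by rwa [one_smul]⟩

theorem loc_mono (h : L ≤ M) : loc p L ≤ loc p M := by
  rintro y ⟨s, hs, hy⟩
  exact ⟨s, hs, h hy⟩

theorem mem_loc_of_smul {s : ℤ} (hs : s ∈ primeTo p) (h : s • y ∈ loc p L) : y ∈ loc p L := by
  obtain ⟨t, ht, h⟩ := h
  exact ⟨t * s, mul_mem ht hs, by rwa [mul_smul]⟩

theorem loc_eq_of_le_of_smul_le (h : L ≤ M) {s : ℤ} (hs : s ∈ primeTo p)
    (hsM : ∀ y ∈ M, s • y ∈ L) : loc p L = loc p M :=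
  le_antisymm (loc_mono h) fun y hy => mem_loc_of_smul hs <| by
    obtain ⟨t, ht, hy⟩ := hy
    exact ⟨t, ht, by rw [smul_comm]; exact hsM _ hy⟩

end Prime

theorem mem_of_forall_mem_loc {L : Submodule ℤ V} {y : V}
    (h : ∀ (p : ℕ) [Fact p.Prime], y ∈ loc p L) : y ∈ L := by
  let multipliers : Ideal ℤ := L.comap (LinearMap.toSpanSingleton ℤ V y)
  obtain ⟨d, hd⟩ := (IsPrincipalIdealRing.principal multipliers).principal
  suffices hunit : d.natAbs = 1 by
    have hone : (1 : ℤ) ∈ multipliers :=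
      hd ▸ Ideal.mem_span_singleton.2 (Int.isUnit_iff_natAbs_eq.2 hunit).dvd
    simpa [multipliers] using hone
  by_contra hne
  obtain ⟨p, hp, hpd⟩ := Nat.exists_prime_and_dvd hne
  have : Fact p.Prime := ⟨hp⟩
  obtain ⟨s, hs, hsy⟩ := h p
  have hds : s ∈ multipliers := hsy
  rw [hd] at hds
  exact hs ((Int.natCast_dvd.2 hpd).trans (Ideal.mem_span_singleton.1 hds))

theorem finite_sublattices {L : Submodule ℤ V} (hL : L.FG) {m : ℤ} (hm : m ≠ 0) :
    {M : Submodule ℤ V | M ≤ L ∧ ∀ z ∈ L, m • z ∈ M}.Finite := by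
  have : Module.Finite ℤ L := Module.Finite.iff_fg.2 hL
  let K : Submodule ℤ L := LinearMap.range (LinearMap.lsmul ℤ L m)
  have hfin : Finite (L ⧸ K) := Module.finite_of_fg_torsion _ fun {q} => by
    obtain ⟨z, rfl⟩ := K.mkQ_surjective q
    exact ⟨⟨m, mem_nonZeroDivisors_of_ne_zero hm⟩,
      (K.mkQ.map_smul m z).symm.trans ((Submodule.Quotient.mk_eq_zero K).2 ⟨z, rfl⟩)⟩
  have : Finite (Submodule ℤ (L ⧸ K)) := Finite.of_injective _ SetLike.coe_injective
  refine (Set.finite_range fun N : Submodule ℤ (L ⧸ K) =>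
    (N.comap K.mkQ).map L.subtype).subset ?_
  rintro M ⟨hML, hmM⟩
  have hK : K ≤ M.comap L.subtype := by
    rintro _ ⟨z, rfl⟩
    exact hmM z z.2
  refine ⟨(M.comap L.subtype).map K.mkQ, ?_⟩
  change ((((M.comap L.subtype).map K.mkQ).comap K.mkQ).map L.subtype) = M
  rw [Submodule.comap_map_mkQ, sup_eq_right.2 hK, Submodule.map_comap_subtype, inf_eq_right.2 hML]

theorem span_range_extendOfIsLattice {ι : Type*} [Module ℚ V] {L : Submodule ℤ V} [L.IsLattice ℚ]
    (e : Module.Basis ι ℤ L) : Submodule.span ℤ (Set.range (e.extendOfIsLattice ℚ)) = L := by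
  have hrange : Set.range (e.extendOfIsLattice ℚ) = L.subtype '' Set.range e := by
    rw [← Set.range_comp]
    exact congrArg Set.range (funext fun i => by simp)
  rw [hrange, ← Submodule.map_span, e.span_eq, Submodule.map_top, Submodule.range_subtype]

end Localization

/-! ### `p`-adic integrality of rational numbers -/

section Padic

variable {p : ℕ} [hp : Fact p.Prime]

theorem norm_intCast_eq_one {s : ℤ} (hs : s ∈ primeTo p) : ‖(s : ℚ_[p])‖ = 1 := by
  rw [Padic.norm_intCast_eq_one_iff, isCoprime_comm]
  exact (Nat.prime_iff_prime_int.1 hp.out).coprime_iff_not_dvd.2 hs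

theorem den_mem_primeTo {c : ℚ} (hc : ‖(c : ℚ_[p])‖ ≤ 1) : (c.den : ℤ) ∈ primeTo p := fun hdvd => by
  have hnorm := PadicInt.isUnit_iff.1 (PadicInt.isUnit_den c hc)
  rw [← Int.cast_natCast] at hnorm
  exact ((PadicInt.norm_int_lt_one_iff_dvd _).2 hdvd).ne hnorm

theorem rat_smul_mem_loc {V : Type*} [AddCommGroup V] [Module ℚ V] {L : Submodule ℤ V} {c : ℚ}
    (hc : ‖(c : ℚ_[p])‖ ≤ 1) {y : V} (hy : y ∈ loc p L) : c • y ∈ loc p L := by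
  refine mem_loc_of_smul (den_mem_primeTo hc) ?_
  have hden : (c.den : ℤ) • c • y = c.num • y := by
    rw [← Int.cast_smul_eq_zsmul ℚ, ← Int.cast_smul_eq_zsmul ℚ, smul_smul, Int.cast_natCast,
      Rat.den_mul_eq_num]
  rw [hden]
  exact Submodule.smul_mem _ _ hy

theorem exists_eq_intCast_of_norm_le_one {c : ℚ}
    (h : ∀ (p : ℕ) [Fact p.Prime], ‖(c : ℚ_[p])‖ ≤ 1) : ∃ n : ℤ, c = n := by
  refine ⟨c.num, (Rat.coe_int_num_of_den_eq_one ?_).symm⟩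
  by_contra hne
  obtain ⟨p, hp, hdvd⟩ := Nat.exists_prime_and_dvd hne
  have : Fact p.Prime := ⟨hp⟩
  exact den_mem_primeTo (h p) (Int.natCast_dvd_natCast.2 hdvd)

theorem eq_of_forall_norm_eq {q r : ℚ} (hq : 0 < q) (hr : 0 < r)
    (h : ∀ (p : ℕ) [Fact p.Prime], ‖(q : ℚ_[p])‖ = ‖(r : ℚ_[p])‖) : q = r := by
  have le_of_norm_le {s t : ℚ} (hs : 0 < s) (ht : 0 < t)
      (hst : ∀ (p : ℕ) [Fact p.Prime], ‖(s : ℚ_[p])‖ ≤ ‖(t : ℚ_[p])‖) : t ≤ s := by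
    obtain ⟨n, hn⟩ := exists_eq_intCast_of_norm_le_one (c := s / t) fun p _ => by
      rw [Rat.cast_div, norm_div]
      exact div_le_one_of_le₀ (hst p) (norm_nonneg _)
    have hn1 : (1 : ℤ) ≤ n := Int.cast_pos.1 (hn ▸ div_pos hs ht)
    rw [← one_le_div₀ ht, hn]
    exact_mod_cast hn1
  exact le_antisymm (le_of_norm_le hr hq fun p _ => (h p).ge)
    (le_of_norm_le hq hr fun p _ => (h p).le)

end Padic

/-! ### Completions of lattices -/

section Completion

variable {α β : ℚ} {p : ℕ} [hp : Fact p.Prime] {L : Submodule ℤ ℍ[ℚ,α,β]}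

theorem toLocal_add (x y : ℍ[ℚ,α,β]) : toLocal p (x + y) = toLocal p x + toLocal p y := by
  ext <;> simp [toLocal]

theorem toLocal_zsmul (n : ℤ) (x : ℍ[ℚ,α,β]) :
    toLocal p (n • x) = (n : ℤ_[p]) • toLocal p x := by
  ext <;> simp [toLocal, Algebra.smul_def]

theorem toLocal_star (x : ℍ[ℚ,α,β]) : toLocal p (star x) = star (toLocal p x) := by
  ext <;> simp [toLocal]

theorem nrd_toLocal (x : ℍ[ℚ,α,β]) : nrd (toLocal p x) = (nrd x : ℚ) := by
  simp [nrd_eq, toLocal]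

theorem trd_toLocal (x : ℍ[ℚ,α,β]) : trd (toLocal p x) = (trd x : ℚ) := by
  simp [trd_eq, toLocal]

variable (p) in
/-- The extension of a rational linear form to the completion `H_p`. -/
def localForm (f : ℍ[ℚ,α,β] →ₗ[ℚ] ℚ) :
    ℍ[ℚ_[p],(α : ℚ_[p]),(β : ℚ_[p])] →ₗ[ℤ_[p]] ℚ_[p] where
  toFun y := y.re * (f ⟨1, 0, 0, 0⟩ : ℚ) + y.imI * (f ⟨0, 1, 0, 0⟩ : ℚ)
    + y.imJ * (f ⟨0, 0, 1, 0⟩ : ℚ) + y.imK * (f ⟨0, 0, 0, 1⟩ : ℚ)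
  map_add' x y := by simp; ring
  map_smul' c x := by
    simp only [QuaternionAlgebra.re_smul, QuaternionAlgebra.imI_smul, QuaternionAlgebra.imJ_smul,
      QuaternionAlgebra.imK_smul, RingHom.id_apply]
    simp only [Algebra.smul_def]
    ring

theorem localForm_toLocal (f : ℍ[ℚ,α,β] →ₗ[ℚ] ℚ) (y : ℍ[ℚ,α,β]) :
    localForm p f (toLocal p y) = (f y : ℚ) := by
  have hcoord : y = y.re • (⟨1, 0, 0, 0⟩ : ℍ[ℚ,α,β]) + y.imI • (⟨0, 1, 0, 0⟩ : ℍ[ℚ,α,β])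
      + y.imJ • (⟨0, 0, 1, 0⟩ : ℍ[ℚ,α,β]) + y.imK • (⟨0, 0, 0, 1⟩ : ℍ[ℚ,α,β]) := by
    ext <;> simp
  have hf := congrArg f hcoord
  simp only [map_add, map_smul, smul_eq_mul] at hf
  rw [hf]
  simp [localForm, toLocal]

theorem mem_localize_of_smul {y : ℍ[ℚ_[p],(α : ℚ_[p]),(β : ℚ_[p])]} {s : ℤ} (hs : s ∈ primeTo p)
    (h : (s : ℤ_[p]) • y ∈ localize p L) : y ∈ localize p L := by
  have hunit : IsUnit (s : ℤ_[p]) := PadicInt.isUnit_iff.2 (norm_intCast_eq_one hs)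
  exact (Submodule.smul_mem_iff_of_isUnit _ hunit).1 h

theorem toLocal_mem_localize_of_mem_loc {y : ℍ[ℚ,α,β]} (hy : y ∈ loc p L) :
    toLocal p y ∈ localize p L := by
  obtain ⟨s, hs, hy⟩ := hy
  refine mem_localize_of_smul hs ?_
  rw [← toLocal_zsmul]
  exact Submodule.subset_span ⟨_, hy, rfl⟩

theorem localize_loc (L : Submodule ℤ ℍ[ℚ,α,β]) : localize p (loc p L) = localize p L := by
  refine le_antisymm (Submodule.span_le.2 ?_) (Submodule.span_mono (Set.image_mono (le_loc L)))
  rintro _ ⟨y, hy, rfl⟩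
  exact toLocal_mem_localize_of_mem_loc hy

theorem norm_coord_le_one {ι : Type*} (b : Module.Basis ι ℚ ℍ[ℚ,α,β]) {y : ℍ[ℚ,α,β]}
    (hy : toLocal p y ∈ localize p (Submodule.span ℤ (Set.range b))) (i : ι) :
    ‖((b.repr y i : ℚ) : ℚ_[p])‖ ≤ 1 := by
  have hle : localize p (Submodule.span ℤ (Set.range b)) ≤
      (LinearMap.range (Algebra.linearMap ℤ_[p] ℚ_[p])).comap (localForm p (b.coord i)) := by
    refine Submodule.span_le.2 ?_
    rintro _ ⟨z, hz, rfl⟩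
    obtain ⟨n, hn⟩ := (b.mem_span_iff_repr_mem ℤ z).1 hz i
    rw [SetLike.mem_coe, Submodule.mem_comap, localForm_toLocal, b.coord_apply, ← hn]
    exact ⟨n, by simp⟩
  obtain ⟨z, hz⟩ := hle hy
  rw [localForm_toLocal, b.coord_apply] at hz
  exact hz ▸ z.2

theorem toLocal_mem_localize_iff (L : Submodule ℤ ℍ[ℚ,α,β]) [L.IsLattice ℚ] (y : ℍ[ℚ,α,β]) :
    toLocal p y ∈ localize p L ↔ y ∈ loc p L := by
  refine ⟨fun h => ?_, toLocal_mem_localize_of_mem_loc⟩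
  let b := (Module.Free.chooseBasis ℤ L).extendOfIsLattice ℚ
  have hb : Submodule.span ℤ (Set.range b) = L := span_range_extendOfIsLattice _
  rw [← hb] at h ⊢
  rw [← b.sum_repr y]
  exact Submodule.sum_mem _ fun i _ =>
    rat_smul_mem_loc (norm_coord_le_one b h i) (le_loc _ (Submodule.subset_span ⟨i, rfl⟩))

theorem loc_eq_of_localize_eq {L M : Submodule ℤ ℍ[ℚ,α,β]} [L.IsLattice ℚ] [M.IsLattice ℚ]
    (h : localize p L = localize p M) : loc p L = loc p M := by
  ext y
  rw [← toLocal_mem_localize_iff, h, toLocal_mem_localize_iff]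

theorem exists_eq_toLocal_add_smul {y : ℍ[ℚ_[p],(α : ℚ_[p]),(β : ℚ_[p])]}
    (hy : y ∈ localize p L) :
    ∃ x ∈ L, ∃ z ∈ localize p L, y = toLocal p x + (p : ℤ_[p]) • z := by
  induction hy using Submodule.span_induction with
  | mem y hy =>
    obtain ⟨x, hx, rfl⟩ := hy
    exact ⟨x, hx, 0, Submodule.zero_mem _, by rw [smul_zero, add_zero]⟩
  | zero => exact ⟨0, L.zero_mem, 0, Submodule.zero_mem _, by ext <;> simp [toLocal]⟩
  | add y y' _ _ h h' =>
    obtain ⟨x, hx, z, hz, rfl⟩ := h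
    obtain ⟨x', hx', z', hz', rfl⟩ := h'
    exact ⟨x + x', L.add_mem hx hx', z + z', Submodule.add_mem _ hz hz', by
      rw [toLocal_add, smul_add]; abel⟩
  | smul c y _ h =>
    obtain ⟨x, hx, z, hz, rfl⟩ := h
    obtain ⟨w, hw⟩ : (p : ℤ_[p]) ∣ c - c.zmodRepr := by
      rw [← Ideal.mem_span_singleton, ← PadicInt.maximalIdeal_eq_span_p]
      exact c.sub_zmodRepr_mem
    refine ⟨(c.zmodRepr : ℤ) • x, L.smul_mem _ hx, w • toLocal p x + c • z,
      Submodule.add_mem _ (Submodule.smul_mem _ _ (Submodule.subset_span ⟨x, hx, rfl⟩))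
        (Submodule.smul_mem _ _ hz), ?_⟩
    rw [toLocal_zsmul, smul_add, smul_add, smul_smul (p : ℤ_[p]), ← hw, smul_comm c, sub_smul,
      Int.cast_natCast]
    abel

section Order

variable {O : Subring ℍ[ℚ,α,β]} {x y : ℍ[ℚ_[p],(α : ℚ_[p]),(β : ℚ_[p])]}

theorem mul_mem_localize (hx : x ∈ localize p (toLat O)) (hy : y ∈ localize p (toLat O)) :
    x * y ∈ localize p (toLat O) := by
  have hxy := Submodule.mul_mem_mul hx hy
  rw [localize, Submodule.span_mul_span] at hxy
  refine Submodule.span_mono ?_ hxy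
  rintro _ ⟨_, ⟨a, ha, rfl⟩, _, ⟨b, hb, rfl⟩, rfl⟩
  exact ⟨a * b, O.mul_mem ha hb, toLocal_mul p a b⟩

variable (p O) in
theorem one_mem_localize : (1 : ℍ[ℚ_[p],(α : ℚ_[p]),(β : ℚ_[p])]) ∈ localize p (toLat O) :=
  Submodule.subset_span ⟨1, O.one_mem, toLocal_one p⟩

theorem mul_mem_loc_order {x y : ℍ[ℚ,α,β]} (hx : x ∈ loc p (toLat O)) (hy : y ∈ loc p (toLat O)) :
    x * y ∈ loc p (toLat O) := by
  obtain ⟨s, hs, hx⟩ := hx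
  obtain ⟨t, ht, hy⟩ := hy
  exact ⟨s * t, mul_mem hs ht, smul_mul_smul_comm s x t y ▸ O.mul_mem hx hy⟩

variable [IsOrder O]

theorem star_mem_localize (hy : y ∈ localize p (toLat O)) : star y ∈ localize p (toLat O) := by
  induction hy using Submodule.span_induction with
  | mem y hy =>
    obtain ⟨x, hx, rfl⟩ := hy
    exact Submodule.subset_span ⟨star x, star_mem_order (O := O) hx, toLocal_star x⟩
  | zero => rw [star_zero]; exact Submodule.zero_mem _
  | add y y' _ _ h h' => rw [star_add]; exact Submodule.add_mem _ h h'
  | smul c y _ h => rw [QuaternionAlgebra.star_smul']; exact Submodule.smul_mem _ _ h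

theorem norm_trd_le_one (hy : y ∈ localize p (toLat O)) : ‖trd y‖ ≤ 1 := by
  induction hy using Submodule.span_induction with
  | mem y hy =>
    obtain ⟨x, hx, rfl⟩ := hy
    obtain ⟨n, hn⟩ := exists_trd_eq_intCast (O := O) hx
    rw [trd_toLocal, hn, Rat.cast_intCast]
    exact Padic.norm_int_le_one n
  | zero => simp [trd_eq]
  | add y y' _ _ h h' => rw [trd_add]; exact (Padic.nonarchimedean _ _).trans (max_le h h')
  | smul c y _ h =>
    rw [trd_smul, norm_mul]
    exact mul_le_one₀ c.2 (norm_nonneg _) h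

theorem norm_nrd_le_one (hy : y ∈ localize p (toLat O)) : ‖nrd y‖ ≤ 1 := by
  induction hy using Submodule.span_induction with
  | mem y hy =>
    obtain ⟨x, hx, rfl⟩ := hy
    obtain ⟨n, hn⟩ := exists_nrd_eq_intCast (O := O) hx
    rw [nrd_toLocal, hn, Rat.cast_intCast]
    exact Padic.norm_int_le_one n
  | zero => simp [nrd_zero]
  | add y y' hy hy' h h' =>
    rw [nrd_add]
    exact (Padic.nonarchimedean _ _).trans (max_le ((Padic.nonarchimedean _ _).trans (max_le h h'))
      (norm_trd_le_one (mul_mem_localize hy (star_mem_localize hy'))))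
  | smul c y _ h =>
    rw [nrd_smul, norm_mul, norm_pow]
    exact mul_le_one₀ (pow_le_one₀ (norm_nonneg _) c.2) (norm_nonneg _) h

theorem norm_nrd_one_add_smul (hy : y ∈ localize p (toLat O)) :
    ‖nrd (1 + (p : ℤ_[p]) • y)‖ = 1 := by
  have hexpand : nrd (1 + (p : ℤ_[p]) • y) = 1 + (p : ℚ_[p]) * (p * nrd y + trd y) := by
    rw [nrd_add, nrd_one, one_mul, nrd_smul, trd_star, trd_smul, map_natCast]
    ring
  have hsmall : ‖(p : ℚ_[p]) * (p * nrd y + trd y)‖ < 1 := by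
    rw [norm_mul]
    refine mul_lt_one_of_nonneg_of_lt_one_left (norm_nonneg _) Padic.norm_p_lt_one
      ((Padic.nonarchimedean _ _).trans (max_le ?_ (norm_trd_le_one hy)))
    rw [norm_mul]
    exact mul_le_one₀ Padic.norm_p_lt_one.le (norm_nonneg _) (norm_nrd_le_one hy)
  rw [hexpand, Padic.add_eq_max_of_ne (by rw [norm_one]; exact hsmall.ne'), norm_one,
    max_eq_left hsmall.le]

theorem exists_mul_eq_one_of_norm_nrd_eq_one (hy : y ∈ localize p (toLat O)) (hn : ‖nrd y‖ = 1) :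
    ∃ z ∈ localize p (toLat O), z * y = 1 := by
  let c : ℤ_[p] := ⟨(nrd y)⁻¹, by rw [norm_inv, hn, inv_one]⟩
  refine ⟨c • star y, Submodule.smul_mem _ _ (star_mem_localize hy), ?_⟩
  have hc : algebraMap ℤ_[p] ℚ_[p] c * nrd y = 1 :=
    inv_mul_cancel₀ (norm_ne_zero_iff.1 (hn ▸ one_ne_zero))
  rw [smul_mul_assoc, star_mul_eq, ← algebraMap_smul ℚ_[p], Algebra.smul_def, ← map_mul, hc,
    map_one]

theorem image_mul_localize_order (hy : y ∈ localize p (toLat O)) (hn : ‖nrd y‖ = 1) :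
    (fun z => z * y) '' (localize p (toLat O) : Set ℍ[ℚ_[p],(α : ℚ_[p]),(β : ℚ_[p])]) =
      localize p (toLat O) := by
  obtain ⟨w, hw, hwy⟩ := exists_mul_eq_one_of_norm_nrd_eq_one hy hn
  refine Set.Subset.antisymm ?_ fun z hz => ⟨z * w, mul_mem_localize hz hw, ?_⟩
  · rintro _ ⟨z, hz, rfl⟩
    exact mul_mem_localize hz hy
  · change z * w * y = z
    rw [mul_assoc, hwy, mul_one]

theorem exists_toLocal_eq_mul
    (hL : (localize p L : Set ℍ[ℚ_[p],(α : ℚ_[p]),(β : ℚ_[p])]) =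
      (fun z => z * x) '' (localize p (toLat O))) :
    ∃ u : ℍ[ℚ,α,β], ∃ v ∈ localize p (toLat O), ‖nrd v‖ = 1 ∧ toLocal p u = v * x := by
  have hxL : x ∈ (localize p L : Set ℍ[ℚ_[p],(α : ℚ_[p]),(β : ℚ_[p])]) :=
    hL ▸ ⟨1, one_mem_localize p O, one_mul x⟩
  obtain ⟨u, -, z, hz, hxu⟩ := exists_eq_toLocal_add_smul hxL
  obtain ⟨o, ho, rfl⟩ : z ∈ (fun z => z * x) '' (localize p (toLat O) : Set _) := hL ▸ hz
  refine ⟨u, 1 + (p : ℤ_[p]) • -o, Submodule.add_mem _ (one_mem_localize p O)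
    (Submodule.smul_mem _ _ (Submodule.neg_mem _ ho)),
    norm_nrd_one_add_smul (Submodule.neg_mem _ ho), ?_⟩
  rw [smul_neg, ← sub_eq_add_neg, sub_mul, one_mul, smul_mul_assoc]
  exact eq_sub_of_add_eq hxu.symm

end Order

end Completion

/-! ### Local generators -/

section LocalGenerator

variable {α β : ℚ} {p : ℕ} [hp : Fact p.Prime] {O : Subring ℍ[ℚ,α,β]}
  {L M : Submodule ℤ ℍ[ℚ,α,β]} {x : (ℍ[ℚ,α,β])ˣ} {z : ℍ[ℚ,α,β]}

theorem loc_mulRight (L : Submodule ℤ ℍ[ℚ,α,β]) (x : (ℍ[ℚ,α,β])ˣ) :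
    loc p (mulRight L x) = mulRight (loc p L) x := by
  ext y
  rw [mem_mulRight_unit, mem_loc, mem_loc]
  simp only [mem_mulRight_unit, smul_mul_assoc]

variable (p O L x) in
/-- The element `x` of the rational algebra generates `L` at `p`, that is, `L_(p) = O_(p) x`.
Working with rational generators instead of generators in `H_p` keeps all lattices inside `H`. -/
def IsLocalGen : Prop :=
  loc p L = mulRight (loc p (toLat O)) x

theorem IsLocalGen.mem_iff (h : IsLocalGen p O L x) : z ∈ loc p L ↔ z * ↑x⁻¹ ∈ loc p (toLat O) := by
  rw [h, mem_mulRight_unit]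

theorem IsLocalGen.self_mem (h : IsLocalGen p O L x) : (x : ℍ[ℚ,α,β]) ∈ loc p L := by
  rw [h.mem_iff, x.mul_inv]
  exact le_loc _ O.one_mem

theorem IsLocalGen.mulRight (h : IsLocalGen p O L x) (y : (ℍ[ℚ,α,β])ˣ) :
    IsLocalGen p O (mulRight L y) (x * y) := by
  rw [IsLocalGen, loc_mulRight, h, mulRight_mulRight, Units.val_mul]

theorem IsLocalGen.congr (h : IsLocalGen p O L x) (hLM : loc p M = loc p L) :
    IsLocalGen p O M x :=
  hLM.trans h

theorem IsLocalGen.mul_mem (h : IsLocalGen p O L x) {o : ℍ[ℚ,α,β]} (ho : o ∈ loc p (toLat O))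
    (hz : z ∈ loc p L) : o * z ∈ loc p L := by
  rw [h.mem_iff] at hz ⊢
  rw [mul_assoc]
  exact mul_mem_loc_order ho hz

theorem isLeftIdeal_of_isLocalGen (hL : L.IsLattice ℚ)
    (h : ∀ (p : ℕ) [Fact p.Prime], ∃ x, IsLocalGen p O L x) : IsLeftIdeal O L := by
  refine ⟨hL, fun p _ => ?_⟩
  obtain ⟨x, hx⟩ := h p
  refine ⟨toLocalUnit p x, ?_⟩
  rw [← localize_loc, hx, localize_mulRight, localize_loc]
  rfl

variable [hO : IsOrder O]

theorem IsLocalGen.norm_nrd_le (h : IsLocalGen p O L x) (hz : z ∈ loc p L) :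
    ‖((nrd z : ℚ) : ℚ_[p])‖ ≤ ‖((nrd (x : ℍ[ℚ,α,β]) : ℚ) : ℚ_[p])‖ := by
  have hle := norm_nrd_le_one (toLocal_mem_localize_of_mem_loc (h.mem_iff.1 hz))
  rw [nrd_toLocal, nrd_mul, nrd_unit_inv, Rat.cast_mul, Rat.cast_inv, norm_mul, norm_inv,
    ← div_eq_mul_inv] at hle
  exact (div_le_one₀ (norm_pos_iff.2 (Rat.cast_ne_zero.2 (nrd_unit_ne_zero x)))).1 hle

theorem IsLocalGen.norm_latticeNorm (h : IsLocalGen p O L x) (hL : L.FG) :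
    ‖(latticeNorm L : ℚ_[p])‖ = ‖((nrd (x : ℍ[ℚ,α,β]) : ℚ) : ℚ_[p])‖ := by
  refine le_antisymm ?_ ?_
  · have hmem : latticeNorm L ∈ Submodule.span ℤ (nrd '' (L : Set ℍ[ℚ,α,β])) :=
      (isGCD_latticeNorm hL).2 ▸ Submodule.mem_span_singleton_self _
    generalize latticeNorm L = g at hmem ⊢
    induction hmem using Submodule.span_induction with
    | mem r hr =>
      obtain ⟨z, hz, rfl⟩ := hr
      exact h.norm_nrd_le (le_loc L hz)
    | zero => rw [Rat.cast_zero, norm_zero]; exact norm_nonneg _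
    | add r s _ _ hr hs =>
      rw [Rat.cast_add]
      exact (Padic.nonarchimedean _ _).trans (max_le hr hs)
    | smul n r _ hr =>
      rw [zsmul_eq_mul, Rat.cast_mul, Rat.cast_intCast, norm_mul]
      exact (mul_le_of_le_one_left (norm_nonneg _) (Padic.norm_int_le_one n)).trans hr
  · obtain ⟨s, hs, hx⟩ := h.self_mem
    obtain ⟨n, hn⟩ := exists_nrd_eq_mul_latticeNorm hL hx
    have hnorm := congrArg (fun r : ℚ => ‖(r : ℚ_[p])‖) hn
    simp only [nrd_smul, eq_intCast, Rat.cast_mul, Rat.cast_pow, Rat.cast_intCast, norm_mul,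
      norm_pow, norm_intCast_eq_one hs, one_pow, one_mul] at hnorm
    rw [hnorm]
    exact mul_le_of_le_one_left (norm_nonneg _) (Padic.norm_int_le_one n)

theorem IsLeftIdeal.exists_isLocalGen (h : IsLeftIdeal O L) (p : ℕ) [Fact p.Prime] :
    ∃ x, IsLocalGen p O L x := by
  have := h.isLattice
  obtain ⟨X, hX⟩ := h.locallyPrincipal p
  obtain ⟨u, v, hv, hnv, huv⟩ := exists_toLocal_eq_mul hX
  have hu : IsUnit u := by
    have hX0 : nrd (X : ℍ[ℚ_[p],(α : ℚ_[p]),(β : ℚ_[p])]) ≠ 0 :=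
      (isUnit_iff_isUnit_nrd.1 X.isUnit).ne_zero
    have hv0 : nrd v ≠ 0 := norm_ne_zero_iff.1 (hnv ▸ one_ne_zero)
    rw [isUnit_iff_isUnit_nrd, isUnit_iff_ne_zero, ← Rat.cast_ne_zero (α := ℚ_[p]), ← nrd_toLocal,
      huv, nrd_mul]
    exact mul_ne_zero hv0 hX0
  obtain ⟨u, rfl⟩ := hu
  have := isLattice_mulRight hO.isLattice u
  refine ⟨u, (loc_eq_of_localize_eq (SetLike.coe_injective ?_)).trans (loc_mulRight (toLat O) u)⟩
  rw [hX, localize_mulRight, huv, ← image_mul_localize_order hv hnv, Set.image_image,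
    image_mul_localize_order hv hnv]
  simp only [mul_assoc]

end LocalGenerator

/-! ### Left ideals and the sets `T_m(a)` -/

section LeftIdeal

variable {α β : ℚ} {O : Subring ℍ[ℚ,α,β]}

theorem LeftIdeal.fg (a : LeftIdeal O) : a.1.FG := a.2.isLattice.fg

theorem LeftIdeal.norm_pos (a : LeftIdeal O) : 0 < latticeNorm a.1 :=
  have := a.2.isLattice
  latticeNorm_pos a.1

theorem LeftIdeal.norm_mul (a : LeftIdeal O) (x : (ℍ[ℚ,α,β])ˣ) :
    latticeNorm (a.mul x).1 = |nrd (x : ℍ[ℚ,α,β])| * latticeNorm a.1 :=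
  latticeNorm_mulRight a.1 x

theorem LeftIdeal.mul_mul (a : LeftIdeal O) (x y : (ℍ[ℚ,α,β])ˣ) :
    (a.mul x).mul y = a.mul (x * y) :=
  Subtype.ext (mulRight_mulRight a.1 x y)

theorem LeftIdeal.mul_one (a : LeftIdeal O) : a.mul 1 = a :=
  Subtype.ext (mulRight_one a.1)

theorem LeftIdeal.mul_eq_iff {a b : LeftIdeal O} {x : (ℍ[ℚ,α,β])ˣ} :
    a.mul x = b ↔ a = b.mul x⁻¹ := by
  constructor
  · rintro rfl
    rw [mul_mul, mul_inv_cancel, mul_one]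
  · rintro rfl
    rw [mul_mul, inv_mul_cancel, mul_one]

theorem mem_transporter {a b : LeftIdeal O} {x : (ℍ[ℚ,α,β])ˣ} :
    x ∈ transporter a b ↔ a.mul x = b :=
  (Subtype.ext_iff (a1 := a.mul x) (a2 := b)).symm

theorem transporter_finite (hα : α < 0) (hβ : β < 0) (a b : LeftIdeal O) :
    (transporter a b).Finite := by
  have := a.2.isLattice
  obtain ⟨n, hn, hna⟩ := exists_ne_zero_smul_mem a.1 (1 : ℍ[ℚ,α,β])
  have : IsAddTorsionFree ℍ[ℚ,α,β] := .of_module_rat _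
  let C : ℚ := n ^ 2 * (latticeNorm b.1 / latticeNorm a.1)
  refine ((finite_nrd_le hα hβ b.fg C).preimage (f := fun x : (ℍ[ℚ,α,β])ˣ => n • (x : ℍ[ℚ,α,β]))
    fun x _ y _ hxy => Units.ext (zsmul_right_injective hn hxy)).subset fun x hx => ?_
  obtain rfl := mem_transporter.1 hx
  refine ⟨mem_mulRight.2 ⟨_, hna, by rw [smul_mul_assoc, one_mul]⟩, ?_⟩
  rw [nrd_smul, eq_intCast]
  refine mul_le_mul_of_nonneg_left ?_ (sq_nonneg _)
  rw [a.norm_mul, mul_div_cancel_right₀ _ a.norm_pos.ne']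
  exact le_abs_self _

theorem nrd_intUnit (m : ℤ) (hm : m ≠ 0) :
    nrd ((intUnit m hm : (ℍ[ℚ,α,β])ˣ) : ℍ[ℚ,α,β]) = (m : ℚ) ^ 2 := by
  rw [← one_mul ((intUnit m hm : (ℍ[ℚ,α,β])ˣ) : ℍ[ℚ,α,β]), mul_intUnit, nrd_smul, nrd_one,
    eq_intCast, mul_one]

theorem intUnit_mul_comm (m : ℤ) (hm : m ≠ 0) (x : (ℍ[ℚ,α,β])ˣ) :
    intUnit m hm * x = x * intUnit m hm :=
  Units.ext <| (Algebra.commutes (m : ℚ) (x : ℍ[ℚ,α,β]))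

theorem mem_heckeSet_trans {m m' : ℕ} {a b c : LeftIdeal O} (hb : b ∈ heckeSet m' a) :
    c ∈ heckeSet m b ↔ c ∈ heckeSet (m * m') a ∧ c.1 ≤ b.1 := by
  have hnorm : ((m * m' : ℕ) : ℚ) * latticeNorm a.1 = m * latticeNorm b.1 := by
    rw [hb.2, Nat.cast_mul, mul_assoc]
  constructor
  · intro hc
    exact ⟨⟨hc.1.trans hb.1, by rw [hc.2, hnorm]⟩, hc.1⟩
  · rintro ⟨hc, hcb⟩
    exact ⟨hcb, by rw [hc.2, hnorm]⟩

theorem heckeSet_zero (a : LeftIdeal O) : heckeSet 0 a = ∅ :=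
  Set.eq_empty_of_forall_notMem fun b hb => b.norm_pos.ne' (by rw [hb.2, Nat.cast_zero, zero_mul])

variable [IsOrder O]

theorem LeftIdeal.order_mul_mem (a : LeftIdeal O) {o z : ℍ[ℚ,α,β]} (ho : o ∈ O) (hz : z ∈ a.1) :
    o * z ∈ a.1 :=
  mem_of_forall_mem_loc fun p _ => by
    obtain ⟨x, hx⟩ := a.2.exists_isLocalGen p
    exact hx.mul_mem (le_loc _ ho) (le_loc _ hz)

theorem star_mem_loc_order {p : ℕ} [Fact p.Prime] {x : ℍ[ℚ,α,β]} (hx : x ∈ loc p (toLat O)) :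
    star x ∈ loc p (toLat O) := by
  obtain ⟨s, hs, hx⟩ := hx
  exact ⟨s, hs, star_zsmul s x ▸ star_mem_order (O := O) hx⟩

/-- Locally `a = O x` and `b = O u x` with `N u = m`, and `m = star u * u`. -/
theorem smul_mem_of_mem_heckeSet {m : ℕ} {a b : LeftIdeal O} (h : b ∈ heckeSet m a)
    {z : ℍ[ℚ,α,β]} (hz : z ∈ a.1) : (m : ℤ) • z ∈ b.1 := by
  refine mem_of_forall_mem_loc fun p _ => ?_
  obtain ⟨x, hx⟩ := a.2.exists_isLocalGen p
  obtain ⟨y, hy⟩ := b.2.exists_isLocalGen p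
  let u := y * x⁻¹
  have hu : (u : ℍ[ℚ,α,β]) ∈ loc p (toLat O) := hx.mem_iff.1 (loc_mono h.1 hy.self_mem)
  have hnorm : ‖((nrd (u : ℍ[ℚ,α,β]) : ℚ) : ℚ_[p])‖ = ‖((m : ℚ) : ℚ_[p])‖ := by
    have hmx := hy.norm_latticeNorm b.fg
    rw [h.2, Rat.cast_mul, norm_mul, hx.norm_latticeNorm a.fg] at hmx
    rw [Units.val_mul, nrd_mul, nrd_unit_inv, Rat.cast_mul, Rat.cast_inv, norm_mul, norm_inv,
      ← hmx, mul_inv_cancel_right₀]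
    exact norm_ne_zero_iff.2 (Rat.cast_ne_zero.2 (nrd_unit_ne_zero x))
  have hratio : ‖((m / nrd (u : ℍ[ℚ,α,β]) : ℚ) : ℚ_[p])‖ ≤ 1 := by
    rw [Rat.cast_div, norm_div, hnorm]
    exact div_self_le_one _
  have hzx : z * ↑x⁻¹ ∈ loc p (toLat O) := hx.mem_iff.1 (le_loc _ hz)
  rw [hy.mem_iff]
  convert rat_smul_mem_loc hratio (mul_mem_loc_order hzx (star_mem_loc_order hu)) using 1
  rw [← nrd_smul_unit_inv, mul_smul_comm, smul_smul, div_mul_cancel₀ _ (nrd_unit_ne_zero u),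
    smul_mul_assoc, ← Int.cast_smul_eq_zsmul ℚ, Int.cast_natCast, mul_inv_rev, inv_inv,
    Units.val_mul, ← mul_assoc, x.inv_mul_cancel_right]

theorem heckeSet_finite (m : ℕ) (a : LeftIdeal O) : (heckeSet m a).Finite := by
  rcases eq_or_ne m 0 with rfl | hm
  · exact heckeSet_zero a ▸ Set.finite_empty
  refine Set.Finite.of_finite_image (f := Subtype.val)
    ((finite_sublattices a.fg (Int.natCast_ne_zero.2 hm)).subset ?_) Subtype.val_injective.injOn
  rintro _ ⟨b, hb, rfl⟩
  exact ⟨hb.1, fun z hz => smul_mem_of_mem_heckeSet hb hz⟩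

theorem eq_of_le_of_norm_eq {a b : LeftIdeal O} (hba : b.1 ≤ a.1)
    (hnorm : latticeNorm b.1 = latticeNorm a.1) : b = a := by
  refine Subtype.ext (le_antisymm hba fun z hz => ?_)
  have hb : b ∈ heckeSet 1 a := ⟨hba, by rw [hnorm, Nat.cast_one, one_mul]⟩
  simpa only [Nat.cast_one, one_smul] using smul_mem_of_mem_heckeSet hb hz

theorem heckeSet_one (a : LeftIdeal O) : heckeSet 1 a = {a} := by
  ext b
  constructor
  · rintro ⟨hba, hnorm⟩
    exact eq_of_le_of_norm_eq hba (by rw [hnorm, Nat.cast_one, one_mul])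
  · rintro rfl
    exact ⟨le_rfl, by rw [Nat.cast_one, one_mul]⟩

theorem mul_intUnit_mem_heckeSet {m : ℕ} (hm : (m : ℤ) ≠ 0) {a b : LeftIdeal O}
    (h : b ∈ heckeSet m a) : a.mul (intUnit m hm) ∈ heckeSet m b := by
  refine ⟨fun y hy => ?_, ?_⟩
  · obtain ⟨z, hz, rfl⟩ := mem_mulRight.1 hy
    rw [mul_intUnit]
    exact smul_mem_of_mem_heckeSet h hz
  · rw [a.norm_mul, nrd_intUnit, h.2, abs_of_nonneg (sq_nonneg _), Int.cast_natCast, sq, mul_assoc]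

theorem mul_mem_heckeSet_iff {m : ℕ} (hm : (m : ℤ) ≠ 0) {a b : LeftIdeal O} {x : (ℍ[ℚ,α,β])ˣ} :
    a.mul x ∈ heckeSet m b ↔ b.mul (intUnit m hm * x⁻¹) ∈ heckeSet m a := by
  constructor <;> intro h
  · have hdual := mul_mem_heckeSet (mul_intUnit_mem_heckeSet hm h) x⁻¹
    rwa [LeftIdeal.mul_mul, LeftIdeal.mul_mul, mul_inv_cancel, LeftIdeal.mul_one] at hdual
  · have hdual := mul_mem_heckeSet (mul_intUnit_mem_heckeSet hm h) ((intUnit m hm)⁻¹ * x)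
    rwa [LeftIdeal.mul_mul, LeftIdeal.mul_mul, intUnit_mul_comm, mul_assoc, mul_inv_cancel_left,
      inv_mul_cancel, LeftIdeal.mul_one] at hdual

end LeftIdeal

/-! ### Self-adjointness of `t_m` -/

section Adjoint

variable {α β : ℚ} {O : Subring ℍ[ℚ,α,β]}

theorem card_transporter_comm (a b : LeftIdeal O) :
    Nat.card (transporter a b) = Nat.card (transporter b a) :=
  Nat.card_congr <| (Equiv.inv _).subtypeEquiv fun x => by
    rw [mem_transporter, mem_transporter, Equiv.inv_apply, LeftIdeal.mul_eq_iff, eq_comm]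

theorem sum_card_transporter (hα : α < 0) (hβ : β < 0) (a : LeftIdeal O) {T : Set (LeftIdeal O)}
    (hT : T.Finite) :
    ∑ c ∈ hT.toFinset, Nat.card (transporter a c) = Nat.card {x | a.mul x ∈ T} := by
  have := hT.fintype
  have (c : LeftIdeal O) : Finite (transporter a c) := transporter_finite hα hβ a c
  rw [Finset.sum_subtype _ fun c => hT.mem_toFinset, ← Nat.card_sigma]
  exact Nat.card_congr
    { toFun := fun s => ⟨s.2, by rw [Set.mem_ofPred_eq, mem_transporter.1 s.2.2]; exact s.1.2⟩
      invFun := fun x => ⟨⟨a.mul x, x.2⟩, x, rfl⟩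
      left_inv := fun ⟨c, x, hx⟩ => Sigma.subtype_ext (Subtype.ext (mem_transporter.1 hx)) rfl
      right_inv := fun x => rfl }

theorem height_single (c d : IdealClass O) (r s : ℝ) :
    height O (Finsupp.single c r) (Finsupp.single d s) = r * (s * heightClass c d) := by
  simp [height]

theorem heightClass_cls (a b : LeftIdeal O) :
    heightClass (cls a) (cls b) = (1 / 2 : ℝ) * Nat.card (transporter a b) := rfl

theorem hecke_single (R : Type*) [CommRing R] (m : ℕ) (c : IdealClass O) (r : R) :
    hecke R O m (Finsupp.single c r) = r • heckeClass R m c :=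
  Finsupp.linearCombination_single R r c

theorem idealModule_hom_ext {R N : Type*} [CommRing R] [AddCommGroup N] [Module R N]
    {f g : IdealModule R O →ₗ[R] N}
    (h : ∀ a : LeftIdeal O, f (Finsupp.single (cls a) 1) = g (Finsupp.single (cls a) 1)) :
    f = g := by
  refine Finsupp.lhom_ext' fun c => LinearMap.ext_ring ?_
  induction c using Quotient.inductionOn with | _ a
  exact h a

variable [IsOrder O]

theorem heckeClass_cls (R : Type*) [CommRing R] (m : ℕ) (a : LeftIdeal O) :
    heckeClass R m (cls a)
      = ∑ b ∈ (heckeSet_finite m a).toFinset, Finsupp.single (cls b) (1 : R) := by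
  change ∑ᶠ b : heckeSet m a, Finsupp.single (cls b.1) (1 : R) = _
  rw [finsum_set_coe_eq_finsum_mem (f := fun b => Finsupp.single (cls b) (1 : R)),
    finsum_mem_eq_finite_toFinset_sum]

theorem sum_card_transporter_heckeSet (hα : α < 0) (hβ : β < 0) (m : ℕ)
    (a b : LeftIdeal O) :
    ∑ c ∈ (heckeSet_finite m a).toFinset, Nat.card (transporter c b)
      = ∑ c ∈ (heckeSet_finite m b).toFinset, Nat.card (transporter a c) := by
  rcases eq_or_ne m 0 with rfl | hm
  · simp only [heckeSet_zero, Set.Finite.toFinset_empty, Finset.sum_empty]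
  simp only [card_transporter_comm _ b]
  rw [sum_card_transporter hα hβ, sum_card_transporter hα hβ]
  have hm' : (m : ℤ) ≠ 0 := Int.natCast_ne_zero.2 hm
  exact Nat.card_congr <| ((Equiv.inv _).trans (Equiv.mulLeft (intUnit m hm'))).subtypeEquiv
    fun x => mul_mem_heckeSet_iff hm'

theorem height_hecke (hα : α < 0) (hβ : β < 0) (m : ℕ) (v w : IdealModule ℝ O) :
    height O (hecke ℝ O m v) w = height O v (hecke ℝ O m w) := by
  suffices h : height O ∘ₗ hecke ℝ O m = (height O).compl₂ (hecke ℝ O m) from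
    LinearMap.congr_fun₂ h v w
  refine idealModule_hom_ext fun a => idealModule_hom_ext fun b => ?_
  simp only [LinearMap.comp_apply, LinearMap.compl₂_apply, hecke_single, heckeClass_cls, one_smul,
    map_sum, LinearMap.sum_apply, height_single, heightClass_cls, one_mul, ← Finset.mul_sum]
  exact_mod_cast congrArg (fun n : ℕ => (1 / 2 : ℝ) * n) (sum_card_transporter_heckeSet hα hβ m a b)

theorem toReal_hecke (m : ℕ) (v : IdealModule ℤ O) :
    toReal (hecke ℤ O m v) = hecke ℝ O m (toReal v) := by
  let realify : IdealModule ℤ O →+ IdealModule ℝ O :=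
    Finsupp.mapRange.addMonoidHom (Int.castAddHom ℝ)
  have realify_single (c : IdealClass O) (n : ℤ) :
      realify (Finsupp.single c n) = Finsupp.single c (n : ℝ) :=
    Finsupp.mapRange_single (hf := Int.cast_zero)
  suffices h : realify.comp (hecke ℤ O m).toAddMonoidHom =
      (hecke ℝ O m).toAddMonoidHom.comp realify from DFunLike.congr_fun h v
  refine Finsupp.addHom_ext fun c n => ?_
  induction c using Quotient.inductionOn with | _ a
  change realify (hecke ℤ O m (Finsupp.single (cls a) n))
    = hecke ℝ O m (realify (Finsupp.single (cls a) n))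
  simp only [realify_single, hecke_single, heckeClass_cls, map_zsmul, map_sum, Int.cast_one,
    Int.cast_smul_eq_zsmul]

end Adjoint

/-! ### Products of Hecke operators -/

section Product

variable {α β : ℚ} {O : Subring ℍ[ℚ,α,β]}

theorem isLeftIdeal_of_forall_loc_eq [IsOrder O] {L : Submodule ℤ ℍ[ℚ,α,β]} (hL : L.IsLattice ℚ)
    (h : ∀ (p : ℕ) [Fact p.Prime], ∃ a : LeftIdeal O, loc p L = loc p a.1) : IsLeftIdeal O L :=
  isLeftIdeal_of_isLocalGen hL fun p _ => by
    obtain ⟨a, ha⟩ := h p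
    obtain ⟨x, hx⟩ := a.2.exists_isLocalGen p
    exact ⟨x, hx.congr ha⟩

variable [IsOrder O]

theorem norm_latticeNorm_eq_of_loc_eq {p : ℕ} [Fact p.Prime] {a b : LeftIdeal O}
    (h : loc p a.1 = loc p b.1) : ‖(latticeNorm a.1 : ℚ_[p])‖ = ‖(latticeNorm b.1 : ℚ_[p])‖ := by
  obtain ⟨x, hx⟩ := b.2.exists_isLocalGen p
  rw [(hx.congr h).norm_latticeNorm a.fg, hx.norm_latticeNorm b.fg]

open Classical in
theorem hecke_heckeClass (R : Type*) [CommRing R] (m m' : ℕ) (a : LeftIdeal O) :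
    hecke R O m (heckeClass R m' (cls a))
      = ∑ c ∈ (heckeSet_finite (m * m') a).toFinset,
        ({b ∈ (heckeSet_finite m' a).toFinset | c.1 ≤ b.1}).card • Finsupp.single (cls c) 1 := by
  rw [heckeClass_cls R, map_sum]
  simp only [hecke_single, one_smul, heckeClass_cls R, ← Finset.sum_const]
  refine Finset.sum_comm' fun b c => ?_
  simp only [Set.Finite.mem_toFinset, Finset.mem_filter]
  rw [and_assoc, and_comm (a := c.1 ≤ b.1)]
  exact and_congr_right fun hb => mem_heckeSet_trans hb

theorem hecke_one (R : Type*) [CommRing R] : hecke R O 1 = LinearMap.id := by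
  refine idealModule_hom_ext fun a => ?_
  have hset : (heckeSet_finite 1 a).toFinset = {a} := by
    rw [← Finset.coe_inj, Set.Finite.coe_toFinset, heckeSet_one, Finset.coe_singleton]
  rw [hecke_single, one_smul, heckeClass_cls, hset, Finset.sum_singleton, LinearMap.id_apply]

/-- Between `c` and `a` lies `{z ∈ a | m z ∈ c}`, which agrees with `a` at the primes not dividing
`m'` and with `c` at those not dividing `m`. -/
theorem exists_intermediate {m m' : ℕ} (hmm : Nat.Coprime m m') {a c : LeftIdeal O}
    (hc : c ∈ heckeSet (m * m') a) :
    ∃ b ∈ heckeSet m' a, c.1 ≤ b.1 ∧ ∀ z ∈ b.1, (m : ℤ) • z ∈ c.1 := by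
  let B : Submodule ℤ ℍ[ℚ,α,β] := a.1 ⊓ c.1.comap (LinearMap.lsmul ℤ _ (m : ℤ))
  have hBa : B ≤ a.1 := inf_le_left
  have hcB : c.1 ≤ B := le_inf hc.1 fun z hz => c.1.smul_mem _ hz
  have hmB (z) (hz : z ∈ B) : (m : ℤ) • z ∈ c.1 := hz.2
  have hmB' (z) (hz : z ∈ a.1) : (m' : ℤ) • z ∈ B := by
    refine ⟨a.1.smul_mem _ hz, ?_⟩
    have := smul_mem_of_mem_heckeSet hc hz
    rwa [Nat.cast_mul, mul_smul] at this
  have := c.2.isLattice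
  have := a.2.isLattice
  have hB : B.IsLattice ℚ := .of_le_of_isLattice_of_fg ℚ hcB (a.fg.of_le hBa)
  have loc_eq (p : ℕ) [Fact p.Prime] : (m' : ℤ) ∈ primeTo p ∧ loc p B = loc p a.1 ∨
      (m : ℤ) ∈ primeTo p ∧ loc p B = loc p c.1 := by
    rcases natCast_mem_primeTo_or_of_coprime (p := p) hmm with hp | hp
    · exact .inr ⟨hp, (loc_eq_of_le_of_smul_le hcB hp hmB).symm⟩
    · exact .inl ⟨hp, loc_eq_of_le_of_smul_le hBa hp hmB'⟩
  let b : LeftIdeal O := ⟨B, isLeftIdeal_of_forall_loc_eq hB fun p _ =>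
    (loc_eq p).elim (fun h => ⟨a, h.2⟩) fun h => ⟨c, h.2⟩⟩
  refine ⟨b, ⟨hBa, ?_⟩, hcB, hmB⟩
  have hm' : m' ≠ 0 := by
    rintro rfl
    rwa [mul_zero, heckeSet_zero] at hc
  have hm'a : 0 < m' * latticeNorm a.1 := mul_pos (by positivity) a.norm_pos
  refine eq_of_forall_norm_eq b.norm_pos hm'a fun p _ => ?_
  rcases loc_eq p with ⟨hp, h⟩ | ⟨hp, h⟩
  · have hunit : ‖(m' : ℚ_[p])‖ = 1 := mod_cast norm_intCast_eq_one hp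
    rw [norm_latticeNorm_eq_of_loc_eq (a := b) h, Rat.cast_mul, norm_mul, Rat.cast_natCast, hunit,
      one_mul]
  · have hunit : ‖(m : ℚ_[p])‖ = 1 := mod_cast norm_intCast_eq_one hp
    rw [norm_latticeNorm_eq_of_loc_eq (a := b) h, hc.2, Nat.cast_mul, mul_assoc, Rat.cast_mul,
      norm_mul, Rat.cast_natCast, hunit, one_mul]

theorem eq_of_smul_mem_of_coprime {m m' : ℕ} (hmm : Nat.Coprime m m') {a b c d : LeftIdeal O}
    (hb : b ∈ heckeSet m' a) (hd : d ∈ heckeSet m' a) (hcd : c.1 ≤ d.1)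
    (hmb : ∀ z ∈ b.1, (m : ℤ) • z ∈ c.1) : b = d := by
  refine eq_of_le_of_norm_eq (fun z hz => ?_) (hb.2.trans hd.2.symm)
  obtain ⟨u, v, huv⟩ := Nat.isCoprime_iff_coprime.2 hmm
  rw [← one_smul ℤ z, ← huv, add_smul, mul_smul, mul_smul]
  exact d.1.add_mem (d.1.smul_mem u (hcd (hmb z hz)))
    (d.1.smul_mem v (smul_mem_of_mem_heckeSet hd (hb.1 hz)))

theorem hecke_mul_of_coprime (R : Type*) [CommRing R] {m m' : ℕ} (hmm : Nat.Coprime m m') :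
    hecke R O (m * m') = hecke R O m ∘ₗ hecke R O m' := by
  classical
  refine idealModule_hom_ext fun a => ?_
  rw [LinearMap.comp_apply, hecke_single, hecke_single, one_smul, one_smul, hecke_heckeClass,
    heckeClass_cls]
  refine Finset.sum_congr rfl fun c hc => ?_
  obtain ⟨b, hb, hcb, hmb⟩ :=
    exists_intermediate hmm ((heckeSet_finite (m * m') a).mem_toFinset.1 hc)
  have hunique : {d ∈ (heckeSet_finite m' a).toFinset | c.1 ≤ d.1} = {b} := by
    ext d
    rw [Finset.mem_filter, Set.Finite.mem_toFinset, Finset.mem_singleton]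
    constructor
    · rintro ⟨hd, hcd⟩
      exact (eq_of_smul_mem_of_coprime hmm hb hd hcd hmb).symm
    · rintro rfl
      exact ⟨hb, hcb⟩
  rw [hunique, Finset.card_singleton, one_smul]

end Product

/-! ### Finiteness of the class number -/

-- Pigeonhole on the fractional parts of `n * c i` for `0 ≤ n ≤ N ^ card ι`, cut into `N` intervals.
theorem exists_natCast_mul_abs_sub_lt_one {ι K : Type*} [Fintype ι] [Field K] [LinearOrder K]
    [IsStrictOrderedRing K] [FloorRing K] (c : ι → K) {N : ℕ} (hN : 0 < N) :
    ∃ n : ℕ, 0 < n ∧ n ≤ N ^ Fintype.card ι ∧ ∃ k : ι → ℤ, ∀ i, N * |n * c i - k i| < 1 := by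
  classical
  have hfloor (x : K) : 0 ≤ ⌊N * Int.fract x⌋ ∧ ⌊N * Int.fract x⌋ < N := by
    refine ⟨Int.floor_nonneg.2 (mul_nonneg N.cast_nonneg (Int.fract_nonneg x)), Int.floor_lt.2 ?_⟩
    rw [Int.cast_natCast]
    exact mul_lt_of_lt_one_right (Nat.cast_pos.2 hN) (Int.fract_lt_one x)
  let box : Fin (N ^ Fintype.card ι + 1) → ι → Fin N := fun n i =>
    ⟨⌊N * Int.fract (n * c i)⌋.toNat, (Int.toNat_lt' hN).2 (hfloor _).2⟩
  obtain ⟨m, n, hne, hbox⟩ := Fintype.exists_ne_map_eq_of_card_lt box (by simp)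
  wlog hlt : m < n generalizing m n
  · exact this n m hne.symm hbox.symm (lt_of_le_of_ne (not_lt.1 hlt) hne.symm)
  have hmn : (m : ℕ) < n := hlt
  refine ⟨n - m, Nat.sub_pos_of_lt hmn, (Nat.sub_le _ _).trans (Nat.le_of_lt_succ n.2),
    fun i => ⌊n * c i⌋ - ⌊m * c i⌋, fun i => ?_⟩
  have hfloor_eq : ⌊N * Int.fract (n * c i)⌋ = ⌊N * Int.fract (m * c i)⌋ := by
    have hnat := congrArg Fin.val (congrFun hbox i)
    rw [← Int.toNat_of_nonneg (hfloor (n * c i)).1, ← Int.toNat_of_nonneg (hfloor (m * c i)).1]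
    exact congrArg _ hnat.symm
  have hsub : ((n - m : ℕ) : K) * c i - ((⌊n * c i⌋ - ⌊m * c i⌋ : ℤ) : K) =
      Int.fract (n * c i) - Int.fract (m * c i) := by
    rw [Nat.cast_sub hmn.le, Int.fract, Int.fract, Int.cast_sub]
    ring
  rw [hsub, ← abs_of_nonneg (N.cast_nonneg : (0 : K) ≤ N), ← abs_mul, mul_sub]
  simpa only [Nat.abs_cast] using Int.abs_sub_lt_one_of_floor_eq_floor hfloor_eq

section ClassNumber

variable {α β : ℚ}

theorem nrd_sum_le (hα : α < 0) (hβ : β < 0) {ι : Type*} (s : Finset ι) (x : ι → ℍ[ℚ,α,β]) :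
    nrd (∑ i ∈ s, x i) ≤ s.card * ∑ i ∈ s, nrd (x i) := by
  have hre : (∑ i ∈ s, x i).re = ∑ i ∈ s, (x i).re := map_sum (QuaternionAlgebra.reₗ ..) _ _
  have hI : (∑ i ∈ s, x i).imI = ∑ i ∈ s, (x i).imI := map_sum (QuaternionAlgebra.imIₗ ..) _ _
  have hJ : (∑ i ∈ s, x i).imJ = ∑ i ∈ s, (x i).imJ := map_sum (QuaternionAlgebra.imJₗ ..) _ _
  have hK : (∑ i ∈ s, x i).imK = ∑ i ∈ s, (x i).imK := map_sum (QuaternionAlgebra.imKₗ ..) _ _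
  have hsum : ∑ i ∈ s, nrd (x i) = ∑ i ∈ s, (x i).re ^ 2 + -α * ∑ i ∈ s, (x i).imI ^ 2 +
      -β * ∑ i ∈ s, (x i).imJ ^ 2 + α * β * ∑ i ∈ s, (x i).imK ^ 2 := by
    simp only [nrd_eq, Finset.mul_sum, ← Finset.sum_add_distrib]
    exact Finset.sum_congr rfl fun i _ => by ring
  have hI' := mul_le_mul_of_nonneg_left
    (sq_sum_le_card_mul_sum_sq (s := s) (f := fun i => (x i).imI)) (neg_nonneg.2 hα.le)
  have hJ' := mul_le_mul_of_nonneg_left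
    (sq_sum_le_card_mul_sum_sq (s := s) (f := fun i => (x i).imJ)) (neg_nonneg.2 hβ.le)
  have hK' := mul_le_mul_of_nonneg_left
    (sq_sum_le_card_mul_sum_sq (s := s) (f := fun i => (x i).imK))
    (mul_pos_of_neg_of_neg hα hβ).le
  have hre' := sq_sum_le_card_mul_sum_sq (s := s) (f := fun i => (x i).re)
  rw [nrd_eq, hsum, hre, hI, hJ, hK]
  linarith

theorem nrd_sum_smul_lt_one (hα : α < 0) (hβ : β < 0) {ι : Type*} [Fintype ι] {b : ι → ℍ[ℚ,α,β]}
    {N : ℚ} (hN : 1 ≤ N) (hb : Fintype.card ι * ∑ i, nrd (b i) < N) {c : ι → ℚ}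
    (hc : ∀ i, N * |c i| < 1) : nrd (∑ i, c i • b i) < 1 := by
  have sum_le : N ^ 2 * ∑ i, nrd (c i • b i) ≤ ∑ i, nrd (b i) := by
    rw [Finset.mul_sum]
    refine Finset.sum_le_sum fun i _ => ?_
    rw [nrd_smul, ← mul_assoc]
    refine mul_le_of_le_one_left (nrd_nonneg hα hβ _) ?_
    rw [Algebra.algebraMap_self, RingHom.id_apply, ← sq_abs (c i), ← mul_pow]
    exact pow_le_one₀ (by positivity) (hc i).le
  have mul_nrd_lt : N ^ 2 * nrd (∑ i, c i • b i) < N ^ 2 * 1 := calc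
    N ^ 2 * nrd (∑ i, c i • b i)
        ≤ N ^ 2 * (Fintype.card ι * ∑ i, nrd (c i • b i)) := by
          gcongr
          exact nrd_sum_le hα hβ _ _
      _ ≤ Fintype.card ι * ∑ i, nrd (b i) := by
          rw [mul_left_comm]
          gcongr
      _ < N := hb
      _ ≤ N ^ 2 * 1 := by nlinarith
  exact lt_of_mul_lt_mul_left mul_nrd_lt (sq_nonneg N)

theorem exists_bounded_smul_near (hα : α < 0) (hβ : β < 0) (L : Submodule ℤ ℍ[ℚ,α,β])
    [L.IsLattice ℚ] : ∃ M : ℕ, ∀ w : ℍ[ℚ,α,β], ∃ n : ℕ, 0 < n ∧ n ≤ M ∧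
      ∃ o ∈ L, nrd ((n : ℤ) • w - o) < 1 := by
  let b := (Module.Free.chooseBasis ℤ L).extendOfIsLattice ℚ
  have hbL (i) : b i ∈ L :=
    (span_range_extendOfIsLattice (Module.Free.chooseBasis ℤ L)).le
      (Submodule.subset_span (Set.mem_range_self i))
  let d := Fintype.card (Module.Free.ChooseBasisIndex ℤ L)
  obtain ⟨N, hN⟩ := exists_nat_gt (max (d * ∑ i, nrd (b i)) 1)
  have hN1 : (1 : ℚ) < N := (le_max_right _ _).trans_lt hN
  refine ⟨N ^ d, fun w => ?_⟩
  obtain ⟨n, hn, hnN, k, hk⟩ := exists_natCast_mul_abs_sub_lt_one (b.repr w)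
    (N := N) (by exact_mod_cast one_pos.trans hN1)
  refine ⟨n, hn, hnN, ∑ i, k i • b i, L.sum_mem fun i _ => L.smul_mem _ (hbL i), ?_⟩
  have hcoord : (n : ℤ) • w - ∑ i, k i • b i = ∑ i, (n * b.repr w i - k i : ℚ) • b i := by
    conv_lhs => rw [← b.sum_repr w]
    rw [Finset.smul_sum, ← Finset.sum_sub_distrib]
    refine Finset.sum_congr rfl fun i _ => ?_
    rw [sub_smul, mul_smul, Int.cast_smul_eq_zsmul, natCast_zsmul, Nat.cast_smul_eq_nsmul]
  rw [hcoord]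
  exact nrd_sum_smul_lt_one hα hβ hN1.le ((le_max_left _ _).trans_lt hN) hk

theorem exists_unit_minimal_nrd (hα : α < 0) (hβ : β < 0) (L : Submodule ℤ ℍ[ℚ,α,β])
    [hL : L.IsLattice ℚ] :
    ∃ u : (ℍ[ℚ,α,β])ˣ, (u : ℍ[ℚ,α,β]) ∈ L ∧ ∀ z ∈ L, nrd z < nrd (u : ℍ[ℚ,α,β]) → z = 0 := by
  obtain ⟨n, hn, hnL⟩ := exists_ne_zero_smul_mem L (1 : ℍ[ℚ,α,β])
  have hne : n • (1 : ℍ[ℚ,α,β]) ≠ 0 := by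
    rw [← Int.cast_smul_eq_zsmul ℚ]
    exact smul_ne_zero (Int.cast_ne_zero.2 hn) one_ne_zero
  obtain ⟨x, ⟨⟨hxL, hx⟩, hx0⟩, hmin⟩ := Set.exists_min_image
    ({x | x ∈ L ∧ nrd x ≤ nrd (n • (1 : ℍ[ℚ,α,β]))} \ {0}) nrd
    (finite_nrd_le hα hβ hL.fg _).sdiff ⟨_, ⟨hnL, le_rfl⟩, hne⟩
  obtain ⟨u, rfl⟩ := isUnit_of_ne_zero hα hβ hx0
  refine ⟨u, hxL, fun z hz hlt => ?_⟩
  by_contra hz0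
  exact (hmin z ⟨⟨hz, hlt.le.trans hx⟩, hz0⟩).not_gt hlt

theorem LeftIdeal.exists_mul_bounded (hα : α < 0) (hβ : β < 0) (O : Subring ℍ[ℚ,α,β])
    [hO : IsOrder O] : ∃ D : ℤ, D ≠ 0 ∧ ∀ a : LeftIdeal O, ∃ u : (ℍ[ℚ,α,β])ˣ,
      toLat O ≤ (a.mul u).1 ∧ ∀ z ∈ (a.mul u).1, D • z ∈ toLat O := by
  have := hO.isLattice
  obtain ⟨M, hM⟩ := exists_bounded_smul_near hα hβ (toLat O)
  refine ⟨M.factorial, by exact_mod_cast M.factorial_ne_zero, fun a => ?_⟩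
  have := a.2.isLattice
  obtain ⟨u, hu, hmin⟩ := exists_unit_minimal_nrd hα hβ a.1
  refine ⟨u⁻¹, fun o ho => mem_mulRight.2
    ⟨o * u, a.order_mul_mem ho hu, Units.mul_inv_cancel_right o u⟩, fun y hy => ?_⟩
  obtain ⟨z, hz, rfl⟩ := mem_mulRight.1 hy
  obtain ⟨n, hn, hnM, o, ho, hlt⟩ := hM (z * ↑u⁻¹)
  have hmul : ((n : ℤ) • (z * ↑u⁻¹) - o) * u = (n : ℤ) • z - o * u := by
    rw [sub_mul, smul_mul_assoc, Units.inv_mul_cancel_right]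
  have hzero : ((n : ℤ) • (z * ↑u⁻¹) - o) * u = 0 := by
    refine hmin _ ?_ ?_
    · rw [hmul]
      exact a.1.sub_mem (a.1.smul_mem _ hz) (a.order_mul_mem ho hu)
    · rw [nrd_mul]
      exact mul_lt_of_lt_one_left (nrd_pos hα hβ u.ne_zero) hlt
  rw [u.mul_left_eq_zero, sub_eq_zero] at hzero
  obtain ⟨k, hk⟩ := Nat.dvd_factorial hn hnM
  rw [hk, Nat.cast_mul, mul_comm, mul_smul, hzero]
  exact (toLat O).smul_mem _ ho

theorem finite_idealClass (hα : α < 0) (hβ : β < 0) (O : Subring ℍ[ℚ,α,β]) [hO : IsOrder O] :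
    Finite (IdealClass O) := by
  obtain ⟨D, hD, hbounded⟩ := LeftIdeal.exists_mul_bounded hα hβ O
  let L := mulRight (toLat O) ((intUnit D hD)⁻¹ : (ℍ[ℚ,α,β])ˣ)
  have hmemL (z : ℍ[ℚ,α,β]) : z ∈ L ↔ D • z ∈ toLat O := by
    rw [mem_mulRight_unit, inv_inv, mul_intUnit]
  let T : Set (LeftIdeal O) := {a | toLat O ≤ a.1 ∧ ∀ z ∈ a.1, D • z ∈ toLat O}
  have hT : T.Finite := by
    refine .of_finite_image (f := Subtype.val) ((finite_sublattices (hO.isLattice.fg.map _) hD :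
      {M | M ≤ L ∧ _}.Finite).subset ?_) Subtype.val_injective.injOn
    rintro _ ⟨a, ⟨hOa, haD⟩, rfl⟩
    exact ⟨fun z hz => (hmemL z).2 (haD z hz), fun z hz => hOa ((hmemL z).1 hz)⟩
  have := hT.to_subtype
  refine Finite.of_surjective (fun a : T => cls a.1) fun c => ?_
  induction c using Quotient.inductionOn with | _ a
  obtain ⟨u, hu⟩ := hbounded a
  exact ⟨⟨a.mul u, hu⟩, cls_mul a u⟩

end ClassNumber

/-! ### The operator `t_0` -/

section HeckeZero

variable {α β : ℚ} {O : Subring ℍ[ℚ,α,β]}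

theorem heightClass_self_pos (hα : α < 0) (hβ : β < 0) (c : IdealClass O) :
    0 < heightClass c c := by
  induction c using Quotient.inductionOn with | _ a
  have := (transporter_finite hα hβ a a).to_subtype
  have : Nonempty (transporter a a) := ⟨⟨1, mulRight_one a.1⟩⟩
  exact mul_pos one_half_pos (Nat.cast_pos.2 Nat.card_pos)

theorem heightClass_of_ne {c d : IdealClass O} (h : c ≠ d) : heightClass c d = 0 := by
  induction c using Quotient.inductionOn with | _ a
  induction d using Quotient.inductionOn with | _ b
  have : IsEmpty (transporter a b) := ⟨fun x =>
    h ((cls_mul a x.1).symm.trans (congrArg cls (mem_transporter.1 x.2)))⟩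
  change (1 / 2 : ℝ) * Nat.card (transporter a b) = 0
  rw [Nat.card_of_isEmpty, Nat.cast_zero, mul_zero]

theorem heightClass_comm (c d : IdealClass O) : heightClass c d = heightClass d c := by
  rcases eq_or_ne c d with rfl | h
  · rfl
  · rw [heightClass_of_ne h, heightClass_of_ne h.symm]

theorem height_comm (v w : IdealModule ℝ O) : height O v w = height O w v := by
  suffices h : height O = (height O).flip from LinearMap.congr_fun₂ h v w
  refine Finsupp.lhom_ext fun c r => Finsupp.lhom_ext fun d s => ?_
  rw [LinearMap.flip_apply, height_single, height_single, heightClass_comm, mul_left_comm]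

variable [IsOrder O]

theorem height_e₀ (hα : α < 0) (hβ : β < 0) (d : IdealClass O) (s : ℝ) :
    height O (e₀ O) (Finsupp.single d s) = s := by
  have := finite_idealClass hα hβ O
  have := Fintype.ofFinite (IdealClass O)
  rw [e₀, finsum_eq_sum_of_fintype, map_sum, LinearMap.sum_apply, Finset.sum_eq_single d]
  · rw [height_single, mul_left_comm, one_div_mul_cancel (heightClass_self_pos hα hβ d).ne',
      mul_one]
  · intro c _ hc
    rw [height_single, heightClass_of_ne hc, mul_zero, mul_zero]
  · exact fun h => absurd (Finset.mem_univ d) h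

theorem height_heckeZero (hα : α < 0) (hβ : β < 0) (v w : IdealModule ℝ O) :
    height O (heckeZero O v) w = height O v (heckeZero O w) := by
  suffices h : height O ∘ₗ heckeZero O = (height O).compl₂ (heckeZero O) from
    LinearMap.congr_fun₂ h v w
  refine Finsupp.lhom_ext fun c r => Finsupp.lhom_ext fun d s => ?_
  simp only [LinearMap.comp_apply, LinearMap.compl₂_apply, heckeZero,
    Finsupp.linearCombination_single, map_smul, LinearMap.smul_apply, smul_eq_mul]
  rw [height_e₀ hα hβ, height_comm, height_e₀ hα hβ]
  ring

end HeckeZero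

/-! ### Splitting quaternion algebras over finite fields -/

theorem exists_ne_zero_apply_eq_zero {K V : Type*} [Field K] [Finite K] [AddCommGroup V]
    [Module K V] (Q : QuadraticForm K V) (hV : 2 < Module.finrank K V) : ∃ v ≠ 0, Q v = 0 := by
  classical
  have := Fintype.ofFinite K
  have := Module.finite_of_finrank_pos (pos_of_gt hV)
  obtain ⟨p, _⟩ := CharP.exists K
  let b := Module.finBasis K V
  let F : MvPolynomial (Fin (Module.finrank K V)) K :=
    ∑ i, ∑ j, MvPolynomial.C (Q.toBilin b (b i) (b j)) * MvPolynomial.X i * MvPolynomial.X j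
  have eval_F (n : Fin (Module.finrank K V) → K) :
      MvPolynomial.eval n F = Q (∑ i, n i • b i) := by
    rw [← congrArg (fun q : QuadraticForm K V => q _) (QuadraticMap.toQuadraticMap_toBilin Q b),
      LinearMap.BilinMap.toQuadraticMap_apply]
    simp only [F, map_sum, map_mul, MvPolynomial.eval_C, MvPolynomial.eval_X, map_smul,
      LinearMap.sum_apply, LinearMap.smul_apply, smul_eq_mul, Finset.mul_sum]
    rw [Finset.sum_comm]
    exact Finset.sum_congr rfl fun i _ => Finset.sum_congr rfl fun j _ => by ring
  have totalDegree_F : F.totalDegree ≤ 2 := by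
    refine MvPolynomial.totalDegree_finsetSum_le fun i _ =>
      MvPolynomial.totalDegree_finsetSum_le fun j _ => ?_
    rw [mul_assoc]
    refine (MvPolynomial.totalDegree_mul _ _).trans ?_
    rw [MvPolynomial.totalDegree_C, zero_add]
    refine (MvPolynomial.totalDegree_mul _ _).trans ?_
    simp only [MvPolynomial.totalDegree_X, Nat.reduceAdd, le_refl]
  have hdvd := char_dvd_card_solutions p (totalDegree_F.trans_lt (by rwa [Fintype.card_fin]))
  have eval_zero : MvPolynomial.eval 0 F = 0 := by
    simp only [eval_F, Pi.zero_apply, zero_smul, Finset.sum_const_zero, QuadraticMap.map_zero]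
  have one_lt_card : 1 < Fintype.card {n // MvPolynomial.eval n F = 0} :=
    (CharP.char_is_prime K p).one_lt.trans_le
      (Nat.le_of_dvd (Fintype.card_pos_iff.2 ⟨⟨0, eval_zero⟩⟩) hdvd)
  obtain ⟨⟨n, hn⟩, hne⟩ := Fintype.exists_ne_of_one_lt_card one_lt_card ⟨0, eval_zero⟩
  refine ⟨∑ i, n i • b i, fun h => hne (Subtype.ext ?_), by rw [← eval_F, hn]⟩
  exact funext (Fintype.linearIndependent_iff.1 b.linearIndependent n h)

/-- A system of matrix units: elements `e i j` of a ring that multiply like the elementary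
matrices. -/
structure IsMatrixUnits {n A : Type*} [Fintype n] [DecidableEq n] [Ring A] (e : n → n → A) :
    Prop where
  mul_eq : ∀ i j k l, e i j * e k l = if j = k then e i l else 0
  sum_diag : ∑ i, e i i = 1

namespace IsMatrixUnits

theorem of_mul_eq {n A : Type*} [Fintype n] [DecidableEq n] [Ring A] {x y : n → A} {f : A}
    (hyx : ∀ j k, y j * x k = if j = k then f else 0) (hf : ∀ i, x i * f = x i)
    (hsum : ∑ i, x i * y i = 1) : IsMatrixUnits fun i j => x i * y j where
  mul_eq i j k l := by
    rw [mul_assoc, ← mul_assoc (y j), hyx]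
    split_ifs
    · rw [← mul_assoc, hf]
    · rw [zero_mul, mul_zero]
  sum_diag := hsum

variable {n K A : Type*} [Fintype n] [DecidableEq n] [Field K] [Ring A] [Algebra K A]
  {e : n → n → A}

theorem sum_smul_mul_sum_smul (he : IsMatrixUnits e) (X Y : Matrix n n K) :
    (∑ i, ∑ j, X i j • e i j) * ∑ i, ∑ j, Y i j • e i j = ∑ i, ∑ j, (X * Y) i j • e i j := by
  simp_rw [Finset.sum_mul, Finset.mul_sum, smul_mul_smul_comm, he.mul_eq, Matrix.mul_apply,
    Finset.sum_smul]
  refine Finset.sum_congr rfl fun i _ => ?_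
  rw [Finset.sum_comm' (t' := Finset.univ) (s' := fun _ => Finset.univ) (by simp)]
  simp only [smul_ite, smul_zero, Finset.sum_ite_irrel, Finset.sum_const_zero, Fintype.sum_ite_eq']
  rw [Finset.sum_comm]

variable (K) in
/-- The homomorphism from the matrix algebra that sends the elementary matrices to given matrix
units. -/
def toAlgHom (he : IsMatrixUnits e) : Matrix n n K →ₐ[K] A :=
  AlgHom.ofLinearMap (∑ i, ∑ j, (Matrix.entryLinearMap K K i j).smulRight (e i j))
    (by
      simp only [LinearMap.sum_apply, LinearMap.smulRight_apply, Matrix.entryLinearMap_apply,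
        Matrix.one_apply, ite_smul, one_smul, zero_smul, Finset.sum_ite_eq, Finset.mem_univ,
        if_true, he.sum_diag])
    (fun X Y => by
      simp only [LinearMap.sum_apply, LinearMap.smulRight_apply, Matrix.entryLinearMap_apply,
        he.sum_smul_mul_sum_smul])

theorem toAlgHom_apply (he : IsMatrixUnits e) (X : Matrix n n K) :
    he.toAlgHom K X = ∑ i, ∑ j, X i j • e i j := by
  simp only [toAlgHom, AlgHom.ofLinearMap_apply, LinearMap.sum_apply, LinearMap.smulRight_apply,
    Matrix.entryLinearMap_apply]

theorem bijective_toAlgHom [Nonempty n] [Nontrivial A] (he : IsMatrixUnits e)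
    (hA : Module.finrank K A = Fintype.card n ^ 2) : Function.Bijective (he.toAlgHom K) := by
  have := Module.finite_of_finrank_pos (R := K) (M := A) (hA ▸ pow_pos Fintype.card_pos 2)
  have := IsSimpleRing.matrix n K
  have hinj : Function.Injective (he.toAlgHom K) := (he.toAlgHom K).toRingHom.injective
  refine ⟨hinj, (LinearMap.injective_iff_surjective_of_finrank_eq_finrank
    (f := (he.toAlgHom K).toLinearMap) ?_).1 hinj⟩
  rw [hA, Module.finrank_matrix, Module.finrank_self, mul_one, sq]

end IsMatrixUnits

/-- A trace and a norm on an algebra, as on a quaternion algebra, in whose terms every element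
satisfies the quadratic equation `x ^ 2 - T x * x + N x = 0`. -/
structure TraceNorm (R A : Type*) [CommRing R] [Ring A] [Algebra R A] where
  T : A →ₗ[R] R
  N : A → R
  T_one : T 1 = 2
  N_add : ∀ x y, N (x + y) = N x + N y + (T x * T y - T (x * y))
  mul_self : ∀ x, x * x = T x • x - N x • 1

namespace TraceNorm

section Ring

variable {R A : Type*} [CommRing R] [Ring A] [Algebra R A] (D : TraceNorm R A)

theorem T_mul_comm (x y : A) : D.T (x * y) = D.T (y * x) := by
  have h := D.N_add x y
  rw [add_comm x y, D.N_add y x] at h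
  linear_combination h

theorem N_smul [FaithfulSMul R A] (c : R) (x : A) : D.N (c • x) = c * c * D.N x := by
  refine FaithfulSMul.algebraMap_injective R A ?_
  have h := D.mul_self (c • x)
  rw [smul_mul_smul_comm, D.mul_self x, map_smul, smul_eq_mul, smul_sub, smul_smul, smul_smul,
    smul_smul, mul_right_comm c _ c] at h
  simpa only [Algebra.algebraMap_eq_smul_one] using (sub_right_injective h).symm

theorem exists_reduction [FaithfulSMul ℤ A] (D : TraceNorm ℤ A) {n : ℕ} {B : Type*} [Ring B]
    [Algebra (ZMod n) B] {π : A →+* B} (hπ : Function.Surjective π)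
    (hker : ∀ x, π x = 0 → ∃ z, x = (n : ℤ) • z) :
    ∃ D' : TraceNorm (ZMod n) B, ∀ x, D'.T (π x) = D.T x ∧ D'.N (π x) = D.N x := by
  let s := Function.surjInv hπ
  have π_s (b : B) : π (s b) = b := Function.surjInv_eq hπ b
  let T₀ : A →+ ZMod n := (Int.castAddHom (ZMod n)).comp D.T.toAddMonoidHom
  have ker_le : π.toAddMonoidHom.ker ≤ T₀.ker := fun x hx => by
    obtain ⟨z, rfl⟩ := hker x hx
    rw [AddMonoidHom.mem_ker, map_zsmul, natCast_zsmul, nsmul_eq_mul, CharP.cast_eq_zero, zero_mul]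
  let T : B →ₗ[ZMod n] ZMod n := AddMonoidHom.toZModLinearMap n <|
    π.toAddMonoidHom.liftOfRightInverse s π_s ⟨T₀, ker_le⟩
  have T_π (x : A) : T (π x) = D.T x :=
    π.toAddMonoidHom.liftOfRightInverse_comp_apply s π_s ⟨T₀, ker_le⟩ x
  let N (b : B) : ZMod n := D.N (s b)
  have N_π (x : A) : N (π x) = D.N x := by
    obtain ⟨z, hz⟩ := hker (s (π x) - x) (by rw [map_sub, π_s, sub_self])
    simp only [N, eq_add_of_sub_eq' hz, D.N_add, D.N_smul, map_smul, mul_smul_comm, smul_eq_mul]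
    push_cast
    rw [ZMod.natCast_self]
    ring
  have smul_π (m : ℤ) (x : A) : (m : ZMod n) • π x = π (m • x) := by
    rw [Int.cast_smul_eq_zsmul, map_zsmul]
  refine ⟨⟨T, N, ?_, hπ.forall₂.2 fun x y => ?_, hπ.forall.2 fun x => ?_⟩,
    fun x => ⟨T_π x, N_π x⟩⟩
  · rw [← map_one π, T_π, D.T_one, Int.cast_ofNat]
  · rw [← map_add π, ← map_mul π, N_π, N_π, N_π, T_π, T_π, T_π, D.N_add]
    push_cast
    rfl
  · rw [T_π, N_π, smul_π, ← map_one π, smul_π, ← map_mul, ← map_sub, D.mul_self]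

end Ring

variable {K A : Type*} [Field K] [Ring A] [Algebra K A] (D : TraceNorm K A)

/-- The norm form as a quadratic form. -/
def quadraticForm [Nontrivial A] : QuadraticForm K A :=
  QuadraticMap.ofPolar D.N (fun c x => D.N_smul c x)
    (fun x y z => by
      simp only [QuadraticMap.polar, D.N_add, add_mul, map_add]
      ring)
    (fun c x y => by
      simp only [QuadraticMap.polar, D.N_add, smul_mul_assoc, map_smul, smul_eq_mul]
      ring)

theorem mul_mul_self_of_N_eq_zero {x : A} (hx : D.N x = 0) (w : A) :
    x * w * x = D.T (x * w) • x := by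
  have hxx : x * x = D.T x • x := by rw [D.mul_self, hx, zero_smul, sub_zero]
  have hpolar : x * w + w * x = D.T x • w + D.T w • x - (D.T x * D.T w - D.T (x * w)) • 1 := by
    have h := D.mul_self (x + w)
    simp only [D.N_add, add_mul, mul_add, D.mul_self x, D.mul_self w, map_add] at h
    linear_combination (norm := module) h
  have h := congrArg (x * ·) hpolar
  simp only [mul_add, mul_sub, ← mul_assoc, hxx, mul_smul_comm, smul_mul_assoc, mul_one] at h
  linear_combination (norm := module) h

theorem mul_mul_self_of_T_eq_one [Nontrivial A] {f : A} (hf : f * f = f) (hT : D.T f = 1)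
    (w : A) : f * w * f = D.T (f * w) • f := by
  refine D.mul_mul_self_of_N_eq_zero ?_ w
  have h := D.mul_self f
  rw [hf, hT, one_smul, eq_sub_iff_add_eq, add_eq_left] at h
  exact (smul_eq_zero.1 h).resolve_right one_ne_zero

variable {D}

theorem exists_idempotent [Finite K] (hA : 2 < Module.finrank K A)
    (hD : ∀ x, (∀ y, D.T (x * y) = 0) → x = 0) : ∃ f, f * f = f ∧ D.T f = 1 := by
  have := Module.nontrivial_of_finrank_pos (pos_of_gt hA)
  obtain ⟨e, he0, he⟩ := exists_ne_zero_apply_eq_zero D.quadraticForm hA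
  obtain ⟨y, hy⟩ : ∃ y, D.T (e * y) ≠ 0 := by
    contrapose! he0
    exact hD e he0
  refine ⟨e * ((D.T (e * y))⁻¹ • y), ?_, ?_⟩
  · rw [mul_smul_comm, smul_mul_smul_comm, ← mul_assoc, D.mul_mul_self_of_N_eq_zero he,
      smul_mul_assoc, smul_smul, mul_assoc, inv_mul_cancel₀ hy, mul_one]
  · rw [mul_smul_comm, map_smul, smul_eq_mul, inv_mul_cancel₀ hy]

theorem exists_mul_mul_ne_zero (hA : 2 < Module.finrank K A)
    (hD : ∀ x, (∀ y, D.T (x * y) = 0) → x = 0) {f g : A} (hfg : f + g = 1)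
    (hf : ∀ w, f * w * f = D.T (f * w) • f) (hg : ∀ w, g * w * g = D.T (g * w) • g) :
    ∃ w, f * w * g ≠ 0 := by
  by_contra! hfwg
  have hgwf (w : A) : g * w * f = 0 := hD _ fun y => by
    rw [mul_assoc, mul_assoc, D.T_mul_comm, mul_assoc, hfwg, mul_zero, map_zero]
  have span_eq_top : Submodule.span K (Set.range ![f, g]) = ⊤ := by
    rw [Matrix.range_cons_cons_empty]
    refine eq_top_iff.2 fun w _ => Submodule.mem_span_pair.2 ⟨D.T (f * w), D.T (g * w), ?_⟩
    calc D.T (f * w) • f + D.T (g * w) • g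
        = f * w * f + f * w * g + (g * w * f + g * w * g) := by
          rw [hf, hg, hfwg, hgwf, add_zero, zero_add]
      _ = (f + g) * w * (f + g) := by noncomm_ring
      _ = w := by rw [hfg, one_mul, mul_one]
  have := finrank_range_le_card (R := K) ![f, g]
  rw [Set.finrank, span_eq_top, finrank_top, Fintype.card_fin] at this
  exact hA.not_ge this

theorem exists_mul_eq_and_mul_eq (hA : 2 < Module.finrank K A)
    (hD : ∀ x, (∀ y, D.T (x * y) = 0) → x = 0) {f g : A} (hfg : f + g = 1) (hff : f * f = f)
    (hgg : g * g = g) (hTf : D.T f = 1) (hTg : D.T g = 1) :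
    ∃ u v, u * v = f ∧ v * u = g ∧ u * g = u ∧ g * v = v ∧ v * f = v := by
  have := Module.nontrivial_of_finrank_pos (pos_of_gt hA)
  have hf := D.mul_mul_self_of_T_eq_one hff hTf
  have hg := D.mul_mul_self_of_T_eq_one hgg hTg
  obtain ⟨w, hw⟩ := exists_mul_mul_ne_zero hA hD hfg hf hg
  obtain ⟨w', hw'⟩ : ∃ w', D.T (f * w * g * w') = 1 := by
    obtain ⟨y, hy⟩ := not_forall.1 (mt (hD (f * w * g)) hw)
    exact ⟨(D.T (f * w * g * y))⁻¹ • y, by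
      rw [mul_smul_comm, map_smul, smul_eq_mul, inv_mul_cancel₀ hy]⟩
  refine ⟨f * w * g, g * w' * f, ?_, ?_, by rw [mul_assoc, hgg],
    by rw [mul_assoc, ← mul_assoc g, hgg], by rw [mul_assoc, hff]⟩
  · calc f * w * g * (g * w' * f) = f * (w * (g * g) * w') * f := by simp only [mul_assoc]
      _ = D.T (f * w * g * w') • f := by rw [hgg, hf]; simp only [mul_assoc]
      _ = f := by rw [hw', one_smul]
  · calc g * w' * f * (f * w * g) = g * (w' * (f * f) * w) * g := by simp only [mul_assoc]
      _ = D.T (f * w * g * w') • g := by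
        rw [hff, hg, D.T_mul_comm, D.T_mul_comm (f * w * g)]; simp only [mul_assoc]
      _ = g := by rw [hw', one_smul]

theorem exists_isMatrixUnits [Finite K] (hA : 2 < Module.finrank K A)
    (hD : ∀ x, (∀ y, D.T (x * y) = 0) → x = 0) :
    ∃ e : Fin 2 → Fin 2 → A, IsMatrixUnits e ∧ ∀ i j, D.T (e i j) = if i = j then 1 else 0 := by
  obtain ⟨f, hf, hTf⟩ := exists_idempotent hA hD
  have hTg : D.T (1 - f) = 1 := by
    rw [map_sub, D.T_one, hTf]
    norm_num
  obtain ⟨u, v, huv, hvu, hug, hgv, hvf⟩ := exists_mul_eq_and_mul_eq hA hD (add_sub_cancel f 1) hf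
    (IsIdempotentElem.one_sub hf) hTf hTg
  have hfv : f * v = 0 := by
    rw [← hgv, ← mul_assoc, IsIdempotentElem.mul_one_sub_self hf, zero_mul]
  have huf : u * f = 0 := by
    rw [← hug, mul_assoc, IsIdempotentElem.one_sub_mul_self hf, mul_zero]
  let x : Fin 2 → A := ![f, v]
  let y : Fin 2 → A := ![f, u]
  have y_mul_x (j k : Fin 2) : y j * x k = if j = k then f else 0 := by
    fin_cases j <;> fin_cases k
    · exact hf
    · exact hfv
    · exact huf
    · exact huv
  refine ⟨fun i j => x i * y j, .of_mul_eq y_mul_x (fun i => ?_) ?_, fun i j => ?_⟩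
  · fin_cases i
    · exact hf
    · exact hvf
  · rw [Fin.sum_univ_two, ← add_sub_cancel f 1]
    exact congrArg₂ (· + ·) hf hvu
  · rw [D.T_mul_comm, y_mul_x, apply_ite D.T, hTf, map_zero]
    simp only [eq_comm]

theorem exists_algEquiv_matrix [Finite K] (hA : Module.finrank K A = 4)
    (hD : ∀ x, (∀ y, D.T (x * y) = 0) → x = 0) :
    ∃ ψ : Matrix (Fin 2) (Fin 2) K ≃ₐ[K] A, ∀ X, D.N (ψ X) = X.det := by
  have h2 : 2 < Module.finrank K A := by rw [hA]; norm_num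
  have := Module.nontrivial_of_finrank_pos (pos_of_gt h2)
  obtain ⟨e, he, hT⟩ := exists_isMatrixUnits h2 hD
  refine ⟨AlgEquiv.ofBijective (he.toAlgHom K) (he.bijective_toAlgHom hA), fun X => ?_⟩
  have T_eq_trace : D.T (he.toAlgHom K X) = X.trace := by
    simp only [he.toAlgHom_apply, map_sum, map_smul, hT, smul_eq_mul, mul_ite, mul_one, mul_zero,
      Fintype.sum_ite_eq, Matrix.trace, Matrix.diag]
  have mul_self_eq : X * X = X.trace • X - X.det • 1 := by
    have := X.aeval_self_charpoly
    rw [Matrix.charpoly_fin_two] at this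
    simp only [map_add, map_sub, map_mul, Polynomial.aeval_X, Polynomial.aeval_C,
      Algebra.algebraMap_eq_smul_one, smul_mul_assoc, one_mul, sq] at this
    linear_combination (norm := module) this
  have h := D.mul_self (he.toAlgHom K X)
  rw [← map_mul, mul_self_eq, map_sub, map_smul, map_smul, map_one, T_eq_trace, sub_right_inj] at h
  exact (smul_left_injective K one_ne_zero h).symm

end TraceNorm

/-! ### Reduction of an order modulo a prime not dividing its discriminant -/

theorem finrank_eq_card_of_basis_int {n : ℕ} [Nontrivial (ZMod n)] {ι M V : Type*} [Fintype ι]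
    [AddCommGroup M] [AddCommGroup V] [Module (ZMod n) V] (b : Module.Basis ι ℤ M) {π : M →+ V}
    (hπ : Function.Surjective π) (hker : ∀ x, π x = 0 → ∃ z, x = (n : ℤ) • z) :
    Module.finrank (ZMod n) V = Fintype.card ι := by
  have sum_smul (m : ι → ℤ) : ∑ i, (m i : ZMod n) • π (b i) = π (∑ i, m i • b i) := by
    simp only [map_sum, map_zsmul, Int.cast_smul_eq_zsmul]
  have hli : LinearIndependent (ZMod n) (π ∘ b) := by
    refine Fintype.linearIndependent_iff.2 fun c hc i => ?_
    choose m hm using fun i => ZMod.intCast_surjective (c i)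
    obtain ⟨z, hz⟩ := hker (∑ i, m i • b i) (by
      simpa only [← sum_smul, hm, Function.comp_apply] using hc)
    have := congrArg (b.repr · i) hz
    simp only [b.repr_sum_self, map_zsmul, Finsupp.smul_apply, smul_eq_mul] at this
    rw [← hm i, this, Int.cast_mul, Int.cast_natCast, ZMod.natCast_self, zero_mul]
  have hspan : ⊤ ≤ Submodule.span (ZMod n) (Set.range (π ∘ b)) := fun v _ => by
    obtain ⟨x, rfl⟩ := hπ v
    rw [← b.sum_repr x, ← sum_smul]
    exact sum_mem fun i _ => Submodule.smul_mem _ _ (Submodule.subset_span ⟨i, rfl⟩)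
  exact Module.finrank_eq_card_basis (Module.Basis.mk hli hspan)

theorem exists_zmod_algebra_quotient.{u} (A : Type u) [Ring A] (n : ℕ) :
    ∃ (B : Type u) (_ : Ring B) (_ : Algebra (ZMod n) B) (π : A →+* B), Function.Surjective π ∧
      ∀ x, π x = 0 ↔ ∃ z, x = (n : ℤ) • z := by
  let I : Ideal A := Ideal.span {(n : A)}
  have mem_I (x : A) : x ∈ I ↔ ∃ z, x = (n : ℤ) • z := by
    rw [Ideal.mem_span_singleton']
    refine exists_congr fun z => ?_
    rw [eq_comm, zsmul_eq_mul, Int.cast_natCast, Nat.cast_comm]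
  have : I.IsTwoSided := ⟨fun {x} y hx => by
    obtain ⟨z, rfl⟩ := (mem_I x).1 hx
    exact (mem_I _).2 ⟨z * y, smul_mul_assoc _ _ _⟩⟩
  let π : A →+* A ⧸ I := Ideal.Quotient.mk I
  have hπ : Function.Surjective π := Ideal.Quotient.mk_surjective
  have π_eq_zero_iff (x : A) : π x = 0 ↔ ∃ z, x = (n : ℤ) • z :=
    Ideal.Quotient.eq_zero_iff_mem.trans (mem_I x)
  let _ : Module (ZMod n) (A ⧸ I) := AddCommGroup.zmodModule <| hπ.forall.2 fun x => by
    rw [← map_nsmul, π_eq_zero_iff]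
    exact ⟨x, (natCast_zsmul x n).symm⟩
  exact ⟨A ⧸ I, inferInstance, ZMod.algebraOfModule n (A ⧸ I), π, hπ, π_eq_zero_iff⟩

theorem exists_eq_smul_of_forall_dvd {R M ι : Type*} [CommRing R] [AddCommGroup M] [Module R M]
    [Fintype ι] [DecidableEq ι] (b : Module.Basis ι R M) (B : LinearMap.BilinForm R M) {r : R}
    (hr : IsCoprime r (LinearMap.BilinForm.toMatrix b B).det) {x : M} (hx : ∀ y, r ∣ B x y) :
    ∃ z, x = r • z := by
  let G := LinearMap.BilinForm.toMatrix b B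
  have vecMul_G (j : ι) : Matrix.vecMul (b.repr x) G j = B x (b j) := by
    conv_rhs => rw [← b.sum_repr x]
    simp only [G, Matrix.vecMul, dotProduct, LinearMap.BilinForm.toMatrix_apply, map_sum, map_smul,
      LinearMap.sum_apply, LinearMap.smul_apply, smul_eq_mul]
  have dvd_repr (i : ι) : r ∣ b.repr x i := by
    have det_smul :
        G.det • ⇑(b.repr x) = Matrix.vecMul (Matrix.vecMul (b.repr x) G) G.adjugate := by
      rw [Matrix.vecMul_vecMul, Matrix.mul_adjugate, Matrix.vecMul_smul, Matrix.vecMul_one]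
    refine hr.dvd_of_dvd_mul_left (?_ : r ∣ G.det * b.repr x i)
    rw [← smul_eq_mul, ← Pi.smul_apply, det_smul]
    exact Finset.dvd_sum fun j _ => Dvd.dvd.mul_right (vecMul_G j ▸ hx (b j)) _
  choose m hm using dvd_repr
  refine ⟨∑ i, m i • b i, ?_⟩
  simp only [Finset.smul_sum, smul_smul, ← hm, b.sum_repr]

namespace TraceNorm

variable {R A : Type*} [CommRing R] [Ring A] [Algebra R A] (D : TraceNorm R A)

/-- The polar form of the norm. -/
def polarBilin : LinearMap.BilinForm R A :=
  (LinearMap.mul R R).compl₁₂ D.T D.T - (LinearMap.mul R A).compr₂ D.T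

theorem polarBilin_apply (x y : A) : D.polarBilin x y = D.T x * D.T y - D.T (x * y) :=
  rfl

theorem exists_eq_smul_of_forall_dvd_T {ι : Type*} [Fintype ι] [DecidableEq ι]
    (b : Module.Basis ι R A) {r : R}
    (hr : IsCoprime r (LinearMap.BilinForm.toMatrix b D.polarBilin).det) {x : A}
    (hx : ∀ y, r ∣ D.T (x * y)) : ∃ z, x = r • z := by
  refine exists_eq_smul_of_forall_dvd b D.polarBilin hr fun y => ?_
  have hx1 := hx 1
  rw [mul_one] at hx1
  exact dvd_sub (hx1.mul_right _) (hx y)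

/-- The homomorphism `φ` identifies the reduction modulo `p` of an algebra with norm with the
`2 × 2` matrices over `ZMod p`. -/
structure IsReduction {A : Type*} [Ring A] (D : TraceNorm ℤ A) {p : ℕ}
    (φ : A →+* Matrix (Fin 2) (Fin 2) (ZMod p)) : Prop where
  surjective : Function.Surjective φ
  eq_zero_iff : ∀ x, φ x = 0 ↔ ∃ z, x = (p : ℤ) • z
  det_eq : ∀ x, (φ x).det = D.N x

theorem exists_isReduction {p : ℕ} [hp : Fact p.Prime] {ι A : Type*}
    [Fintype ι] [DecidableEq ι] [Ring A] (D : TraceNorm ℤ A) (b : Module.Basis ι ℤ A)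
    (hι : Fintype.card ι = 4)
    (hdet : ¬ (p : ℤ) ∣ (LinearMap.BilinForm.toMatrix b D.polarBilin).det) :
    ∃ φ : A →+* Matrix (Fin 2) (Fin 2) (ZMod p), D.IsReduction φ := by
  have : Nontrivial A := Module.nontrivial_of_finrank_pos (R := ℤ)
    (by rw [Module.finrank_eq_card_basis b, hι]; norm_num)
  have := Module.Free.of_basis b
  obtain ⟨B, _, _, π, hπ, π_eq_zero_iff⟩ := exists_zmod_algebra_quotient A p
  obtain ⟨D', hD'⟩ := D.exists_reduction hπ fun x hx => (π_eq_zero_iff x).1 hx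
  have D'_nondegenerate : ∀ x, (∀ y, D'.T (x * y) = 0) → x = 0 :=
    hπ.forall.2 fun x hx => (π_eq_zero_iff x).2 <| D.exists_eq_smul_of_forall_dvd_T b
      ((Nat.prime_iff_prime_int.1 hp.out).coprime_iff_not_dvd.2 hdet) fun y => by
        rw [← ZMod.intCast_zmod_eq_zero_iff_dvd, ← (hD' _).1, map_mul, hx]
  have finrank_eq : Module.finrank (ZMod p) B = 4 :=
    (finrank_eq_card_of_basis_int b (π := π.toAddMonoidHom) hπ
      fun x hx => (π_eq_zero_iff x).1 hx).trans hι
  obtain ⟨ψ, hψ⟩ := TraceNorm.exists_algEquiv_matrix finrank_eq D'_nondegenerate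
  refine ⟨ψ.symm.toRingEquiv.toRingHom.comp π, ψ.symm.surjective.comp hπ, fun x => ?_, fun x => ?_⟩
  · rw [← π_eq_zero_iff]
    exact map_eq_zero_iff _ ψ.symm.injective
  · rw [← (hD' x).2, ← ψ.apply_symm_apply (π x), hψ]
    rfl

end TraceNorm

section Quaternion

variable {R : Type*} [CommRing R] {a b : R}

theorem mul_self_eq (x : ℍ[R,a,b]) : x * x = trd x • x - nrd x • 1 := by
  ext <;> simp [nrd_eq, trd_eq] <;> ring

theorem trd_mul_star (x y : ℍ[R,a,b]) : trd (x * star y) = trd x * trd y - trd (x * y) := by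
  simp [trd_eq]; ring

theorem isSquare_det_trd_mul_star {ι : Type*} [Fintype ι] [DecidableEq ι]
    (hι : Fintype.card ι = 4) (v : ι → ℍ[R,a,b]) :
    IsSquare (Matrix.of fun i j => trd (v i * star (v j))).det := by
  let e := Fintype.equivFinOfCardEq hι
  let P : Matrix (Fin 4) (Fin 4) R := Matrix.of fun i =>
    ![(v (e.symm i)).re, (v (e.symm i)).imI, (v (e.symm i)).imJ, (v (e.symm i)).imK]
  let D : Matrix (Fin 4) (Fin 4) R := Matrix.diagonal ![2, -2 * a, -2 * b, 2 * a * b]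
  have h : (Matrix.of fun i j => trd (v i * star (v j))).submatrix e.symm e.symm
      = P * D * P.transpose := by
    ext i j
    simp [P, D, Matrix.mul_apply, Fin.sum_univ_four, trd_eq, Matrix.diagonal_apply]
    ring
  rw [← Matrix.det_submatrix_equiv_self e.symm, h, Matrix.det_mul, Matrix.det_mul,
    Matrix.det_transpose, Matrix.det_diagonal, Fin.prod_univ_four]
  exact ⟨4 * a * b * P.det, by simp; ring⟩

end Quaternion

section Order

variable {α β : ℚ} {O : Subring ℍ[ℚ,α,β]} [IsOrder O]

theorem intCast_num_trd (x : O) : ((trd (x : ℍ[ℚ,α,β])).num : ℚ) = trd (x : ℍ[ℚ,α,β]) := by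
  obtain ⟨n, hn⟩ := exists_trd_eq_intCast x.2
  rw [hn, Rat.num_intCast]

theorem intCast_num_nrd (x : O) : ((nrd (x : ℍ[ℚ,α,β])).num : ℚ) = nrd (x : ℍ[ℚ,α,β]) := by
  obtain ⟨n, hn⟩ := exists_nrd_eq_intCast x.2
  rw [hn, Rat.num_intCast]

variable (O) in
/-- The reduced trace and norm of an order, with values in `ℤ`. -/
def orderTraceNorm : TraceNorm ℤ O where
  T := AddMonoidHom.toIntLinearMap <| AddMonoidHom.mk' (fun x : O => (trd (x : ℍ[ℚ,α,β])).num)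
    fun x y => by
      refine Int.cast_injective (α := ℚ) ?_
      rw [Int.cast_add, intCast_num_trd, intCast_num_trd, intCast_num_trd]
      exact trd_add _ _
  N x := (nrd (x : ℍ[ℚ,α,β])).num
  T_one := by
    refine Int.cast_injective (α := ℚ) ?_
    simp [trd_eq]
  N_add x y := by
    refine Int.cast_injective (α := ℚ) ?_
    simp only [Int.cast_add, Int.cast_sub, Int.cast_mul, AddMonoidHom.coe_toIntLinearMap,
      AddMonoidHom.mk'_apply, intCast_num_trd, intCast_num_nrd]
    exact (nrd_add _ _).trans (congrArg _ (trd_mul_star _ _))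
  mul_self x := by
    refine Subtype.ext ((mul_self_eq (x : ℍ[ℚ,α,β])).trans ?_)
    rw [← intCast_num_trd, ← intCast_num_nrd, Int.cast_smul_eq_zsmul, Int.cast_smul_eq_zsmul]
    rfl

theorem coe_orderTraceNorm_T (x : O) : ((orderTraceNorm O).T x : ℚ) = trd (x : ℍ[ℚ,α,β]) :=
  intCast_num_trd x

theorem coe_orderTraceNorm_N (x : O) : ((orderTraceNorm O).N x : ℚ) = nrd (x : ℍ[ℚ,α,β]) :=
  intCast_num_nrd x

variable (O) in
/-- The integral basis of an order that defines its discriminant. -/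
def orderBasis : Module.Basis (Module.Free.ChooseBasisIndex ℤ (toLat O)) ℤ O :=
  (Module.Free.chooseBasis ℤ (toLat O)).map
    (AddEquiv.toIntLinearEquiv (AddEquiv.refl O : (toLat O) ≃+ O))

theorem card_orderBasis : Fintype.card (Module.Free.ChooseBasisIndex ℤ (toLat O)) = 4 := by
  rw [← Module.finrank_eq_card_basis
    ((Module.Free.chooseBasis ℤ (toLat O)).extendOfIsLattice ℚ), QuaternionAlgebra.finrank_eq_four]

variable (O) in
/-- The Gram matrix of the reduced norm of an order in an integral basis. -/
def gramMatrix : Matrix (Module.Free.ChooseBasisIndex ℤ (toLat O))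
    (Module.Free.ChooseBasisIndex ℤ (toLat O)) ℤ :=
  LinearMap.BilinForm.toMatrix (orderBasis O) (orderTraceNorm O).polarBilin

theorem intCast_gramMatrix_apply (i j : Module.Free.ChooseBasisIndex ℤ (toLat O)) :
    (gramMatrix O i j : ℚ) =
      trd ((orderBasis O i : ℍ[ℚ,α,β]) * star (orderBasis O j : ℍ[ℚ,α,β])) := by
  rw [gramMatrix, LinearMap.BilinForm.toMatrix_apply, TraceNorm.polarBilin_apply, trd_mul_star,
    Int.cast_sub, Int.cast_mul, coe_orderTraceNorm_T, coe_orderTraceNorm_T, coe_orderTraceNorm_T,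
    Subring.coe_mul]

theorem gramDet_order : gramDet (toLat O) = (gramMatrix O).det := by
  rw [gramDet, Int.cast_det]
  congr 1
  ext i j
  rw [Matrix.of_apply, Matrix.map_apply, intCast_gramMatrix_apply]
  simp only [QuadraticMap.polar, normForm, latticeNorm_order, div_one, nrd_add]
  rw [add_assoc, add_sub_cancel_left, add_sub_cancel_left]
  rfl

theorem disc_order_sq : disc (toLat O) ^ 2 = (gramMatrix O).det.natAbs := by
  obtain ⟨d, hd⟩ : IsSquare (gramMatrix O).det := by
    rw [← Rat.isSquare_intCast_iff, Int.cast_det]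
    have gram_eq : (gramMatrix O).map (Int.cast : ℤ → ℚ) = Matrix.of fun i j =>
        trd ((orderBasis O i : ℍ[ℚ,α,β]) * star (orderBasis O j : ℍ[ℚ,α,β])) :=
      Matrix.ext intCast_gramMatrix_apply
    rw [gram_eq]
    exact isSquare_det_trd_mul_star card_orderBasis _
  rw [disc, gramDet_order, Rat.num_intCast, hd, Int.natAbs_mul, Nat.sqrt_eq, sq]

theorem exists_isReduction_of_not_dvd_disc {p : ℕ} [hp : Fact p.Prime]
    (hd : ¬ p ∣ disc (toLat O)) :
    ∃ φ : O →+* Matrix (Fin 2) (Fin 2) (ZMod p), (orderTraceNorm O).IsReduction φ :=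
  (orderTraceNorm O).exists_isReduction (orderBasis O) card_orderBasis fun h =>
    hd (hp.out.dvd_of_dvd_pow (disc_order_sq (O := O) ▸ Int.natCast_dvd.1 h))

end Order

/-! ### Ideals of index `p` and lines over the field of `p` elements -/

section LineMatrix

variable {K : Type*} [CommRing K]

/-- A matrix of rank one whose kernel is the line spanned by `v`, when `v ≠ 0`. -/
def lineMatrix (v : Fin 2 → K) : Matrix (Fin 2) (Fin 2) K := !![v 1, -v 0; 0, 0]

theorem det_lineMatrix (v : Fin 2 → K) : (lineMatrix v).det = 0 := by
  simp [lineMatrix, Matrix.det_fin_two]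

theorem lineMatrix_mulVec (v : Fin 2 → K) : (lineMatrix v).mulVec v = 0 := by
  ext i
  fin_cases i <;> simp [lineMatrix, Matrix.mulVec, dotProduct, Fin.sum_univ_two]
  ring

theorem lineMatrix_ne_zero {v : Fin 2 → K} (hv : v ≠ 0) : lineMatrix v ≠ 0 := by
  contrapose! hv
  ext i
  fin_cases i
  · simpa [lineMatrix] using congrFun₂ hv 0 1
  · simpa [lineMatrix] using congrFun₂ hv 0 0

theorem mul_adjugate_lineMatrix {v : Fin 2 → K} {X : Matrix (Fin 2) (Fin 2) K}
    (h : X.mulVec v = 0) : X * (lineMatrix v).adjugate = 0 := by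
  ext i j
  have hi := congrFun h i
  simp only [Matrix.mulVec, dotProduct, Fin.sum_univ_two, Pi.zero_apply] at hi
  fin_cases j <;> simp [lineMatrix, Matrix.adjugate_fin_two, Matrix.mul_apply, Fin.sum_univ_two, hi]

theorem exists_det_lineMatrix_add_eq_one {K : Type*} [Field K] {v : Fin 2 → K} (hv : v ≠ 0) :
    ∃ X : Matrix (Fin 2) (Fin 2) K, X.det = 0 ∧ (lineMatrix v + X).det = 1 := by
  obtain ⟨i, hi⟩ := Function.ne_iff.1 hv
  let w : Fin 2 → K := Pi.single i (v i)⁻¹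
  have hvw : v ⬝ᵥ w = 1 := by rw [dotProduct_single, mul_inv_cancel₀ hi]
  refine ⟨!![0, 0; w 0, w 1], by simp [Matrix.det_fin_two], ?_⟩
  simpa [lineMatrix, Matrix.det_fin_two, dotProduct, Fin.sum_univ_two, add_comm] using hvw

theorem eq_of_mulVec_rep_eq_zero {K : Type*} [Field K] {X : Matrix (Fin 2) (Fin 2) K}
    (hX : X ≠ 0) {l m : Projectivization K (Fin 2 → K)} (hl : X.mulVec l.rep = 0)
    (hm : X.mulVec m.rep = 0) : l = m := by
  by_contra hlm
  have span_eq_top : Submodule.span K (Set.range ![l.rep, m.rep]) = ⊤ :=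
    (Projectivization.linearIndependent_pair_iff_ne.2 hlm).span_eq_top_of_card_eq_finrank'
      (by simp)
  have mulVecLin_eq_zero : X.mulVecLin = 0 := LinearMap.ext_on_range span_eq_top fun i => by
    fin_cases i
    · exact hl
    · exact hm
  exact hX (Matrix.toLin'.injective (mulVecLin_eq_zero.trans (map_zero _).symm))

end LineMatrix

namespace TraceNorm.IsReduction

variable {A : Type*} [Ring A] {D : TraceNorm ℤ A} {p : ℕ}
  {φ : A →+* Matrix (Fin 2) (Fin 2) (ZMod p)}

theorem trace_eq (hφ : D.IsReduction φ) (x : A) : (φ x).trace = D.T x := by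
  have h := congrArg (Int.cast : ℤ → ZMod p) (D.N_add x 1)
  have hN1 := hφ.det_eq 1
  rw [map_one, Matrix.det_one] at hN1
  rw [D.T_one, mul_one] at h
  push_cast at h
  rw [← hφ.det_eq, ← hφ.det_eq, map_add, map_one, ← hN1, Matrix.det_fin_two,
    Matrix.det_fin_two] at h
  simp only [Matrix.add_apply, Matrix.one_apply_eq, Matrix.one_apply_ne zero_ne_one,
    Matrix.one_apply_ne one_ne_zero, add_zero] at h
  rw [Matrix.trace_fin_two]
  linear_combination h

theorem adjugate_eq (hφ : D.IsReduction φ) (x : A) : (φ x).adjugate = φ (D.T x • 1 - x) := by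
  rw [map_sub, map_zsmul, map_one, ← Int.cast_smul_eq_zsmul (ZMod p), ← hφ.trace_eq x]
  ext i j
  fin_cases i <;> fin_cases j <;> simp [Matrix.adjugate_fin_two, Matrix.trace_fin_two]

theorem exists_eq_lineMatrix [hp : Fact p.Prime] [FaithfulSMul ℤ A] (hφ : D.IsReduction φ)
    {v : Fin 2 → ZMod p} (hv : v ≠ 0) :
    ∃ y, φ y = lineMatrix v ∧ ∃ n ∈ primeTo p, D.N y = p * n := by
  obtain ⟨X, hX, hvX⟩ := exists_det_lineMatrix_add_eq_one hv
  obtain ⟨y, hy⟩ := hφ.surjective (lineMatrix v)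
  obtain ⟨w, rfl⟩ := hφ.surjective X
  have hNy : (D.N y : ZMod p) = 0 := by rw [← hφ.det_eq, hy, det_lineMatrix]
  have hNw : (D.N w : ZMod p) = 0 := by rw [← hφ.det_eq, hX]
  obtain ⟨n, hn⟩ := (ZMod.intCast_zmod_eq_zero_iff_dvd _ _).1 hNy
  by_cases hpn : n ∈ primeTo p
  · exact ⟨y, hy, n, hpn, hn⟩
  set B := D.T y * D.T w - D.T (y * w) with hB
  have hNB : (B : ZMod p) = 1 := by
    have h := congrArg (Int.cast : ℤ → ZMod p) (D.N_add y w)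
    rw [← hB, Int.cast_add, Int.cast_add, hNy, hNw, ← hφ.det_eq, map_add, hy, hvX] at h
    linear_combination -h
  refine ⟨y + (p : ℤ) • w, ?_, n + B + p * D.N w, fun h => hpn fun hd => ?_, ?_⟩
  · rw [map_add, (hφ.eq_zero_iff _).2 ⟨w, rfl⟩, add_zero, hy]
  · have h := (ZMod.intCast_zmod_eq_zero_iff_dvd _ _).2 h
    rw [Int.cast_add, Int.cast_add, (ZMod.intCast_zmod_eq_zero_iff_dvd _ _).2 hd, hNB, zero_add,
      Int.cast_mul, Int.cast_natCast, ZMod.natCast_self, zero_mul, add_zero] at h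
    exact one_ne_zero h
  · rw [D.N_add, D.N_smul, mul_smul_comm, map_smul, map_smul, hn, hB, smul_eq_mul, smul_eq_mul]
    ring

end TraceNorm.IsReduction

section LineIdeal

variable {α β : ℚ} {O : Subring ℍ[ℚ,α,β]} {p : ℕ}

/-- The elements of `L` in the order `O` whose reduction `φ` kills the vector `v`. -/
def lineSubmodule (φ : O →+* Matrix (Fin 2) (Fin 2) (ZMod p)) (L : Submodule ℤ ℍ[ℚ,α,β])
    (v : Fin 2 → ZMod p) : Submodule ℤ ℍ[ℚ,α,β] :=
  L ⊓ (((Matrix.mulVec.addMonoidHomLeft v).comp φ.toAddMonoidHom).ker.map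
    O.subtype.toAddMonoidHom).toIntSubmodule

variable {φ : O →+* Matrix (Fin 2) (Fin 2) (ZMod p)} {L : Submodule ℤ ℍ[ℚ,α,β]}
  {v : Fin 2 → ZMod p}

theorem mem_lineSubmodule {z : ℍ[ℚ,α,β]} :
    z ∈ lineSubmodule φ L v ↔ z ∈ L ∧ ∃ x : O, (φ x).mulVec v = 0 ∧ (x : ℍ[ℚ,α,β]) = z :=
  Iff.rfl

theorem coe_mem_lineSubmodule {x : O} :
    (x : ℍ[ℚ,α,β]) ∈ lineSubmodule φ L v ↔ (x : ℍ[ℚ,α,β]) ∈ L ∧ (φ x).mulVec v = 0 := by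
  simp only [mem_lineSubmodule, Subtype.coe_inj, exists_eq_right]

theorem lineSubmodule_le : lineSubmodule φ L v ≤ L := inf_le_left

variable [IsOrder O]

theorem smul_mem_lineSubmodule (hφ : (orderTraceNorm O).IsReduction φ) (hL : L ≤ toLat O)
    {z : ℍ[ℚ,α,β]} (hz : z ∈ L) : (p : ℤ) • z ∈ lineSubmodule φ L v :=
  ⟨L.smul_mem _ hz, (p : ℤ) • ⟨z, hL hz⟩, by
    change (φ _).mulVec v = 0
    rw [(hφ.eq_zero_iff _).2 ⟨_, rfl⟩, Matrix.zero_mulVec], rfl⟩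

variable [hp : Fact p.Prime]

theorem isLattice_lineSubmodule (hφ : (orderTraceNorm O).IsReduction φ) (hL : L ≤ toLat O)
    (hlat : L.IsLattice ℚ) : (lineSubmodule φ L v).IsLattice ℚ := by
  have hp0 : (p : ℤ) ≠ 0 := Int.natCast_ne_zero.2 hp.out.ne_zero
  have := isLattice_mulRight hlat (intUnit p hp0)
  refine .of_le_of_isLattice_of_fg ℚ (M := mulRight L (intUnit p hp0 : (ℍ[ℚ,α,β])ˣ)) ?_
    (hlat.fg.of_le lineSubmodule_le)
  intro y hy
  obtain ⟨z, hz, rfl⟩ := mem_mulRight.1 hy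
  rw [mul_intUnit]
  exact smul_mem_lineSubmodule hφ hL hz

theorem loc_lineSubmodule_of_ne (hφ : (orderTraceNorm O).IsReduction φ) (hL : L ≤ toLat O)
    {q : ℕ} [hq : Fact q.Prime] (hqp : q ≠ p) : loc q (lineSubmodule φ L v) = loc q L :=
  loc_eq_of_le_of_smul_le lineSubmodule_le
    (fun h => hqp ((Nat.prime_dvd_prime_iff_eq hq.out hp.out).1 (Int.natCast_dvd_natCast.1 h)))
    fun _ => smul_mem_lineSubmodule hφ hL

/-- The product `x * star y` reduces to `0`, as `star y` reduces to the adjugate of `φ y`. -/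
theorem smul_mul_inv_mem_order (hφ : (orderTraceNorm O).IsReduction φ) {x y : O} {n : ℤ}
    (hx : (φ x).mulVec v = 0) (hy : φ y = lineMatrix v) (hN : (orderTraceNorm O).N y = p * n)
    {u : (ℍ[ℚ,α,β])ˣ} (hu : (u : ℍ[ℚ,α,β]) = y) : n • ((x : ℍ[ℚ,α,β]) * ↑u⁻¹) ∈ O := by
  have hstar : (((orderTraceNorm O).T y • 1 - y : O) : ℍ[ℚ,α,β]) = star (y : ℍ[ℚ,α,β]) := by
    rw [star_eq_trd_sub, ← coe_orderTraceNorm_T]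
    simp
  have hφ0 : φ (x * ((orderTraceNorm O).T y • 1 - y)) = 0 := by
    rw [map_mul, ← hφ.adjugate_eq, hy, mul_adjugate_lineMatrix hx]
  obtain ⟨o, ho⟩ := (hφ.eq_zero_iff _).1 hφ0
  have hnrd : nrd (u : ℍ[ℚ,α,β]) = p * n := by
    rw [hu, ← coe_orderTraceNorm_N, hN, Int.cast_mul, Int.cast_natCast]
  have hmul : (p : ℤ) • n • ((x : ℍ[ℚ,α,β]) * ↑u⁻¹) = (p : ℤ) • (o : ℍ[ℚ,α,β]) := by
    have hz : ((x : ℍ[ℚ,α,β]) * ↑u⁻¹) * (u * star (u : ℍ[ℚ,α,β])) = (p : ℤ) • (o : ℍ[ℚ,α,β]) := by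
      rw [← mul_assoc, Units.inv_mul_cancel_right, hu, ← hstar]
      exact congrArg Subtype.val ho
    rw [← hz, mul_star_eq, hnrd, ← Algebra.commutes, ← Algebra.smul_def, mul_smul,
      ← Int.cast_smul_eq_zsmul ℚ (p : ℤ), ← Int.cast_smul_eq_zsmul ℚ n, Int.cast_natCast]
  have := IsAddTorsionFree.of_module_rat ℍ[ℚ,α,β]
  rw [smul_right_injective _ (Int.natCast_ne_zero.2 hp.out.ne_zero) hmul]
  exact o.2

theorem isLocalGen_lineSubmodule (hφ : (orderTraceNorm O).IsReduction φ)
    (hloc : loc p L = loc p (toLat O)) {y : O} (hy : φ y = lineMatrix v) {n : ℤ}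
    (hn : n ∈ primeTo p) (hN : (orderTraceNorm O).N y = p * n) {u : (ℍ[ℚ,α,β])ˣ}
    (hu : (u : ℍ[ℚ,α,β]) = y) : IsLocalGen p O (lineSubmodule φ L v) u := by
  ext z
  rw [mem_mulRight_unit]
  constructor
  · rintro ⟨t, ht, -, x, hx, hxz⟩
    refine ⟨n * t, mul_mem hn ht, ?_⟩
    rw [mul_smul, ← smul_mul_assoc, ← hxz]
    exact smul_mul_inv_mem_order hφ hx hy hN hu
  · rintro ⟨t, ht, hz⟩
    let o : O := ⟨t • (z * ↑u⁻¹), hz⟩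
    have hoy : ((o * y : O) : ℍ[ℚ,α,β]) = t • z := by
      rw [Subring.coe_mul, ← hu, smul_mul_assoc, Units.inv_mul_cancel_right]
    obtain ⟨s, hs, hsL⟩ : t • z ∈ loc p L := hloc ▸ le_loc _ (hoy ▸ (o * y).2)
    refine ⟨s * t, mul_mem hs ht, ?_⟩
    rw [mul_smul]
    rw [← hoy] at hsL ⊢
    refine (coe_mem_lineSubmodule (x := s • (o * y))).2 ⟨hsL, ?_⟩
    rw [map_zsmul, map_mul, hy, Matrix.smul_mulVec, ← Matrix.mulVec_mulVec, lineMatrix_mulVec,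
      Matrix.mulVec_zero, smul_zero]

theorem exists_isLocalGen_lineSubmodule (hφ : (orderTraceNorm O).IsReduction φ)
    (hloc : loc p L = loc p (toLat O)) (hv : v ≠ 0) :
    ∃ u, IsLocalGen p O (lineSubmodule φ L v) u ∧
      ‖((nrd (u : ℍ[ℚ,α,β]) : ℚ) : ℚ_[p])‖ = ‖(p : ℚ_[p])‖ := by
  have := Module.Free.of_basis (orderBasis O)
  obtain ⟨y, hy, n, hn, hN⟩ := hφ.exists_eq_lineMatrix hv
  have hnrd : nrd (y : ℍ[ℚ,α,β]) = p * n := by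
    rw [← coe_orderTraceNorm_N, hN, Int.cast_mul, Int.cast_natCast]
  have hnrd0 : nrd (y : ℍ[ℚ,α,β]) ≠ 0 := by
    rw [hnrd]
    exact mul_ne_zero (Nat.cast_ne_zero.2 hp.out.ne_zero)
      (Int.cast_ne_zero.2 fun h0 => hn (h0 ▸ dvd_zero _))
  obtain ⟨u, hu⟩ := isUnit_iff_isUnit_nrd.2 hnrd0.isUnit
  refine ⟨u, isLocalGen_lineSubmodule hφ hloc hy hn hN hu, ?_⟩
  rw [hu, hnrd, Rat.cast_mul, norm_mul, Rat.cast_intCast, norm_intCast_eq_one hn, mul_one,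
    Rat.cast_natCast]

variable {a : LeftIdeal O}

theorem isLeftIdeal_lineSubmodule (hφ : (orderTraceNorm O).IsReduction φ) (ha : a.1 ≤ toLat O)
    (hloc : loc p a.1 = loc p (toLat O)) (hv : v ≠ 0) :
    IsLeftIdeal O (lineSubmodule φ a.1 v) :=
  isLeftIdeal_of_isLocalGen (isLattice_lineSubmodule hφ ha a.2.isLattice) fun q _ => by
    rcases eq_or_ne q p with rfl | hqp
    · obtain ⟨u, hu, -⟩ := exists_isLocalGen_lineSubmodule hφ hloc hv
      exact ⟨u, hu⟩
    · obtain ⟨x, hx⟩ := a.2.exists_isLocalGen q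
      exact ⟨x, hx.congr (loc_lineSubmodule_of_ne hφ ha hqp)⟩

/-- The ideal of index `p` in `a` that corresponds to the line `l`. -/
def lineIdeal (hφ : (orderTraceNorm O).IsReduction φ) (ha : a.1 ≤ toLat O)
    (hloc : loc p a.1 = loc p (toLat O)) (l : Projectivization (ZMod p) (Fin 2 → ZMod p)) :
    LeftIdeal O :=
  ⟨lineSubmodule φ a.1 l.rep, isLeftIdeal_lineSubmodule hφ ha hloc l.rep_nonzero⟩

theorem norm_latticeNorm_of_loc_eq_order (hloc : loc p a.1 = loc p (toLat O)) :
    ‖(latticeNorm a.1 : ℚ_[p])‖ = 1 := by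
  have hgen : IsLocalGen p O a.1 1 := hloc.trans (mulRight_one _).symm
  rw [hgen.norm_latticeNorm a.fg, Units.val_one, nrd_one, Rat.cast_one, norm_one]

theorem lineIdeal_mem_heckeSet (hφ : (orderTraceNorm O).IsReduction φ) (ha : a.1 ≤ toLat O)
    (hloc : loc p a.1 = loc p (toLat O)) (l : Projectivization (ZMod p) (Fin 2 → ZMod p)) :
    lineIdeal hφ ha hloc l ∈ heckeSet p a := by
  refine ⟨lineSubmodule_le, eq_of_forall_norm_eq (lineIdeal hφ ha hloc l).norm_pos
    (mul_pos (Nat.cast_pos.2 hp.out.pos) a.norm_pos) fun q _ => ?_⟩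
  rw [Rat.cast_mul, norm_mul, Rat.cast_natCast]
  rcases eq_or_ne q p with rfl | hqp
  · obtain ⟨u, hu, hnrd⟩ := exists_isLocalGen_lineSubmodule hφ hloc l.rep_nonzero
    rw [norm_latticeNorm_of_loc_eq_order hloc, mul_one, ← hnrd]
    exact hu.norm_latticeNorm (lineIdeal hφ ha hloc l).fg
  · rw [norm_latticeNorm_eq_of_loc_eq (b := a) (loc_lineSubmodule_of_ne hφ ha hqp),
      Padic.norm_natCast_eq_one_iff.2 ((Nat.coprime_primes Fact.out hp.out).2 hqp), one_mul]

theorem exists_mulVec_rep_eq_zero (hφ : (orderTraceNorm O).IsReduction φ) (ha : a.1 ≤ toLat O)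
    (hnorm : ‖(latticeNorm a.1 : ℚ_[p])‖ < 1) :
    ∃ l : Projectivization (ZMod p) (Fin 2 → ZMod p),
      ∀ x : O, (x : ℍ[ℚ,α,β]) ∈ a.1 → (φ x).mulVec l.rep = 0 := by
  obtain ⟨u, hu⟩ := a.2.exists_isLocalGen p
  obtain ⟨t, ht, htu⟩ := hu.self_mem
  let y : O := ⟨t • (u : ℍ[ℚ,α,β]), ha htu⟩
  have hdet : (φ y).det = 0 := by
    rw [hφ.det_eq, ZMod.intCast_zmod_eq_zero_iff_dvd, ← Padic.norm_intCast_lt_one_iff,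
      ← Rat.cast_intCast, coe_orderTraceNorm_N]
    change ‖((nrd (t • (u : ℍ[ℚ,α,β])) : ℚ) : ℚ_[p])‖ < 1
    rwa [← Int.cast_smul_eq_zsmul ℚ, nrd_smul, Rat.cast_mul, norm_mul, ← hu.norm_latticeNorm a.fg,
      Algebra.algebraMap_self_apply, Rat.cast_pow, Rat.cast_intCast, norm_pow,
      norm_intCast_eq_one ht, one_pow, one_mul]
  obtain ⟨v, hv, hyv⟩ := Matrix.exists_mulVec_eq_zero_iff.2 hdet
  obtain ⟨c, hc⟩ := Projectivization.exists_smul_eq_mk_rep (ZMod p) v hv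
  refine ⟨.mk _ v hv, fun x hx => ?_⟩
  obtain ⟨r, hr, ho⟩ := hu.mem_iff.1 (le_loc _ hx)
  let o : O := ⟨r • ((x : ℍ[ℚ,α,β]) * ↑u⁻¹), ho⟩
  have hoy : (t * r) • x = o * y := by
    refine Subtype.ext ?_
    change (t * r) • (x : ℍ[ℚ,α,β]) = r • ((x : ℍ[ℚ,α,β]) * ↑u⁻¹) * t • (u : ℍ[ℚ,α,β])
    rw [smul_mul_smul_comm, Units.inv_mul_cancel_right, mul_comm]
  have hxv : ((t * r : ℤ) : ZMod p) • (φ x).mulVec v = 0 := by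
    rw [← Matrix.smul_mulVec, Int.cast_smul_eq_zsmul, ← map_zsmul, hoy, map_mul,
      ← Matrix.mulVec_mulVec, hyv, Matrix.mulVec_zero]
  have htr : ((t * r : ℤ) : ZMod p) ≠ 0 := fun h =>
    mul_mem ht hr ((ZMod.intCast_zmod_eq_zero_iff_dvd _ _).1 h)
  rw [← hc, Units.smul_def, Matrix.mulVec_smul, (smul_eq_zero.1 hxv).resolve_left htr, smul_zero]

theorem exists_le_lineIdeal (hφ : (orderTraceNorm O).IsReduction φ) (ha : a.1 ≤ toLat O)
    (hloc : loc p a.1 = loc p (toLat O)) {c : LeftIdeal O} (hca : c.1 ≤ a.1)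
    (hnorm : ‖(latticeNorm c.1 : ℚ_[p])‖ < 1) : ∃ l, c.1 ≤ (lineIdeal hφ ha hloc l).1 := by
  obtain ⟨l, hl⟩ := exists_mulVec_rep_eq_zero hφ (hca.trans ha) hnorm
  exact ⟨l, fun z hz => ⟨hca hz, ⟨z, ha (hca hz)⟩, hl _ hz, rfl⟩⟩

theorem exists_eq_lineIdeal (hφ : (orderTraceNorm O).IsReduction φ) (ha : a.1 ≤ toLat O)
    (hloc : loc p a.1 = loc p (toLat O)) {b : LeftIdeal O} (hb : b ∈ heckeSet p a) :
    ∃ l, b = lineIdeal hφ ha hloc l := by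
  obtain ⟨l, hl⟩ := exists_le_lineIdeal hφ ha hloc hb.1 <| by
    rw [hb.2, Rat.cast_mul, norm_mul, norm_latticeNorm_of_loc_eq_order hloc, mul_one,
      Rat.cast_natCast]
    exact Padic.norm_p_lt_one
  exact ⟨l, eq_of_le_of_norm_eq hl (hb.2.trans (lineIdeal_mem_heckeSet hφ ha hloc l).2.symm)⟩

theorem eq_of_mem_lineIdeal (hφ : (orderTraceNorm O).IsReduction φ) (ha : a.1 ≤ toLat O)
    (hloc : loc p a.1 = loc p (toLat O)) {x : O} (hx : φ x ≠ 0)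
    {l m : Projectivization (ZMod p) (Fin 2 → ZMod p)}
    (hl : (x : ℍ[ℚ,α,β]) ∈ (lineIdeal hφ ha hloc l).1)
    (hm : (x : ℍ[ℚ,α,β]) ∈ (lineIdeal hφ ha hloc m).1) : l = m :=
  eq_of_mulVec_rep_eq_zero hx (coe_mem_lineSubmodule.1 hl).2 (coe_mem_lineSubmodule.1 hm).2

theorem lineIdeal_injective (hφ : (orderTraceNorm O).IsReduction φ) (ha : a.1 ≤ toLat O)
    (hloc : loc p a.1 = loc p (toLat O)) : Function.Injective (lineIdeal hφ ha hloc) := by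
  intro l m hlm
  obtain ⟨y, hy⟩ := hφ.surjective (lineMatrix l.rep)
  obtain ⟨s, hs, hsy⟩ : (y : ℍ[ℚ,α,β]) ∈ loc p a.1 := hloc ▸ le_loc _ y.2
  have hφsy : φ (s • y) = (s : ZMod p) • lineMatrix l.rep := by
    rw [map_zsmul, hy, Int.cast_smul_eq_zsmul]
  have hφsy_ne : φ (s • y) ≠ 0 := by
    rw [hφsy]
    exact smul_ne_zero (mt (ZMod.intCast_zmod_eq_zero_iff_dvd _ _).1 hs)
      (lineMatrix_ne_zero l.rep_nonzero)
  have hmem : ((s • y : O) : ℍ[ℚ,α,β]) ∈ (lineIdeal hφ ha hloc l).1 :=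
    coe_mem_lineSubmodule.2
      ⟨hsy, by rw [hφsy, Matrix.smul_mulVec, lineMatrix_mulVec, smul_zero]⟩
  exact eq_of_mem_lineIdeal hφ ha hloc hφsy_ne hmem (hlm ▸ hmem)

theorem exists_eq_smul_of_reduction_eq_zero (hφ : (orderTraceNorm O).IsReduction φ)
    (hloc : loc p L = loc p (toLat O)) {x : O} (hx : (x : ℍ[ℚ,α,β]) ∈ L) (hx0 : φ x = 0) :
    ∃ w ∈ L, (x : ℍ[ℚ,α,β]) = (p : ℤ) • w := by
  obtain ⟨w, rfl⟩ := (hφ.eq_zero_iff x).1 hx0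
  obtain ⟨s, hs, hsw⟩ : (w : ℍ[ℚ,α,β]) ∈ loc p L := hloc ▸ le_loc _ w.2
  obtain ⟨c, d, hcd⟩ := (Nat.prime_iff_prime_int.1 hp.out).coprime_iff_not_dvd.2 hs
  refine ⟨w, ?_, rfl⟩
  rw [← one_smul ℤ (w : ℍ[ℚ,α,β]), ← hcd, add_smul, mul_smul, mul_smul]
  exact L.add_mem (L.smul_mem c hx) (L.smul_mem d hsw)

variable (p) in
theorem exists_mul_le_order (a : LeftIdeal O) :
    ∃ g, (a.mul g).1 ≤ toLat O ∧ loc p (a.mul g).1 = loc p (toLat O) := by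
  obtain ⟨x, hx⟩ := a.2.exists_isLocalGen p
  have hloc : loc p (a.mul x⁻¹).1 = loc p (toLat O) := by
    have hgen := hx.mulRight x⁻¹
    rwa [mul_inv_cancel, IsLocalGen, Units.val_one, mulRight_one] at hgen
  obtain ⟨s, hs, hsO⟩ := exists_common_smul_mem (primeTo p) (a.mul x⁻¹).fg fun z hz =>
    (hloc ▸ le_loc _ hz : z ∈ loc p (toLat O))
  have hs0 : s ≠ 0 := fun h0 => hs (h0 ▸ dvd_zero _)
  refine ⟨x⁻¹ * intUnit s hs0, ?_⟩
  rw [← LeftIdeal.mul_mul]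
  constructor
  · intro y hy
    obtain ⟨z, hz, rfl⟩ := mem_mulRight.1 hy
    rw [mul_intUnit]
    exact hsO z hz
  · rw [← hloc]
    refine loc_eq_of_le_of_smul_le ?_ hs fun z hz => ?_
    · intro y hy
      obtain ⟨z, hz, rfl⟩ := mem_mulRight.1 hy
      rw [mul_intUnit]
      exact (a.mul x⁻¹).1.smul_mem s hz
    · exact mem_mulRight.2 ⟨z, hz, mul_intUnit _ _ _⟩

end LineIdeal

/-! ### Powers of a prime not dividing the discriminant -/

section PrimePower

variable {α β : ℚ} {O : Subring ℍ[ℚ,α,β]} {p : ℕ}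

theorem mul_intUnit_mem_heckeSet_and_le_iff {m : ℕ} {a c : LeftIdeal O} (hp0 : (p : ℤ) ≠ 0) :
    c.mul (intUnit p hp0) ∈ heckeSet (m * p * p) a ∧
      (c.mul (intUnit p hp0)).1 ≤ (a.mul (intUnit p hp0)).1 ↔ c ∈ heckeSet m a := by
  have norm_eq : latticeNorm (c.mul (intUnit p hp0)).1 = ((m * p * p : ℕ) : ℚ) * latticeNorm a.1 ↔
      latticeNorm c.1 = m * latticeNorm a.1 := by
    have hp2 : (p : ℚ) ^ 2 ≠ 0 := pow_ne_zero 2 (mod_cast hp0)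
    rw [c.norm_mul, nrd_intUnit, abs_of_nonneg (sq_nonneg _), Int.cast_natCast,
      ← mul_right_inj' hp2 (b := latticeNorm c.1)]
    push_cast
    ring_nf
  refine ⟨fun ⟨hc, hca⟩ => ⟨fun z hz => ?_, norm_eq.1 hc.2⟩,
    fun hc => ⟨⟨fun y hy => ?_, norm_eq.2 hc.2⟩, mulRight_mono hc.1 _⟩⟩
  · have hmem := mem_mulRight_unit.1 (hca (mem_mulRight.2 ⟨z, hz, rfl⟩))
    rwa [Units.mul_inv_cancel_right] at hmem
  · obtain ⟨z, hz, rfl⟩ := mem_mulRight.1 hy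
    rw [mul_intUnit]
    exact a.1.smul_mem p (hc.1 hz)

variable [IsOrder O]

open Classical in
theorem sum_heckeSet_le_intUnit (R : Type*) [CommRing R] (m : ℕ) (a : LeftIdeal O)
    (hp0 : (p : ℤ) ≠ 0) :
    ∑ c ∈ (heckeSet_finite (m * p * p) a).toFinset with c.1 ≤ (a.mul (intUnit p hp0)).1,
      Finsupp.single (cls c) (1 : R) = heckeClass R m (cls a) := by
  let mulEquiv : LeftIdeal O ≃ LeftIdeal O :=
    { toFun c := c.mul (intUnit p hp0)
      invFun c := c.mul (intUnit p hp0)⁻¹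
      left_inv c := by
        change (c.mul _).mul _ = c
        rw [LeftIdeal.mul_mul, mul_inv_cancel, LeftIdeal.mul_one]
      right_inv c := by
        change (c.mul _).mul _ = c
        rw [LeftIdeal.mul_mul, inv_mul_cancel, LeftIdeal.mul_one] }
  rw [heckeClass_cls R]
  symm
  refine Finset.sum_equiv mulEquiv (fun c => ?_) fun c _ => by rw [← cls_mul c (intUnit p hp0)]; rfl
  rw [Set.Finite.mem_toFinset, Finset.mem_filter, Set.Finite.mem_toFinset]
  exact (mul_intUnit_mem_heckeSet_and_le_iff hp0).symm

variable [hp : Fact p.Prime]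

open Classical in
theorem card_intermediate_of_le_intUnit {φ : O →+* Matrix (Fin 2) (Fin 2) (ZMod p)}
    (hφ : (orderTraceNorm O).IsReduction φ) {a c : LeftIdeal O} (ha : a.1 ≤ toLat O)
    (hloc : loc p a.1 = loc p (toLat O)) {hp0 : (p : ℤ) ≠ 0}
    (hc : c.1 ≤ (a.mul (intUnit p hp0)).1) :
    ({b ∈ (heckeSet_finite p a).toFinset | c.1 ≤ b.1}).card = p + 1 := by
  let _ := Fintype.ofFinite (Projectivization (ZMod p) (Fin 2 → ZMod p))
  have intermediate_eq : {b ∈ (heckeSet_finite p a).toFinset | c.1 ≤ b.1}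
      = Finset.univ.image (lineIdeal hφ ha hloc) := by
    ext b
    simp only [Finset.mem_filter, Set.Finite.mem_toFinset, Finset.mem_image, Finset.mem_univ,
      true_and]
    constructor
    · rintro ⟨hb, -⟩
      obtain ⟨l, rfl⟩ := exists_eq_lineIdeal hφ ha hloc hb
      exact ⟨l, rfl⟩
    · rintro ⟨l, rfl⟩
      refine ⟨lineIdeal_mem_heckeSet hφ ha hloc l, fun z hz => ?_⟩
      obtain ⟨w, hw, rfl⟩ := mem_mulRight.1 (hc hz)
      rw [mul_intUnit]
      exact smul_mem_lineSubmodule hφ ha hw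
  rw [intermediate_eq, Finset.card_image_of_injective _ (lineIdeal_injective hφ ha hloc),
    Finset.card_univ, ← Nat.card_eq_fintype_card,
    Projectivization.card_of_finrank_two (ZMod p) _ (Module.finrank_fin_fun _), Nat.card_zmod]

open Classical in
theorem card_intermediate_of_not_le_intUnit {φ : O →+* Matrix (Fin 2) (Fin 2) (ZMod p)}
    (hφ : (orderTraceNorm O).IsReduction φ) {a c : LeftIdeal O} (ha : a.1 ≤ toLat O)
    (hloc : loc p a.1 = loc p (toLat O)) (hca : c.1 ≤ a.1)
    (hnorm : ‖(latticeNorm c.1 : ℚ_[p])‖ < 1) {hp0 : (p : ℤ) ≠ 0}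
    (hc : ¬ c.1 ≤ (a.mul (intUnit p hp0)).1) :
    ({b ∈ (heckeSet_finite p a).toFinset | c.1 ≤ b.1}).card = 1 := by
  obtain ⟨z, hz, hza⟩ := SetLike.not_le_iff_exists.1 hc
  let x : O := ⟨z, ha (hca hz)⟩
  have hx : φ x ≠ 0 := fun hx0 => hza <| by
    obtain ⟨w, hw, hzw⟩ := exists_eq_smul_of_reduction_eq_zero hφ hloc (x := x) (hca hz) hx0
    exact mem_mulRight.2 ⟨w, hw, (mul_intUnit _ _ _).trans hzw.symm⟩
  obtain ⟨l, hl⟩ := exists_le_lineIdeal hφ ha hloc hca hnorm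
  refine Finset.card_eq_one.2 ⟨lineIdeal hφ ha hloc l, ?_⟩
  ext b
  simp only [Finset.mem_filter, Set.Finite.mem_toFinset, Finset.mem_singleton]
  constructor
  · rintro ⟨hb, hcb⟩
    obtain ⟨m, rfl⟩ := exists_eq_lineIdeal hφ ha hloc hb
    rw [eq_of_mem_lineIdeal hφ ha hloc hx (hl hz) (hcb hz)]
  · rintro rfl
    exact ⟨lineIdeal_mem_heckeSet hφ ha hloc l, hl⟩

theorem hecke_prime_pow (R : Type*) [CommRing R] (hd : ¬ p ∣ disc (toLat O)) (k : ℕ) :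
    hecke R O (p ^ (k + 2))
      = hecke R O (p ^ (k + 1)) ∘ₗ hecke R O p - (p : R) • hecke R O (p ^ k) := by
  classical
  have hp0 : (p : ℤ) ≠ 0 := Int.natCast_ne_zero.2 hp.out.ne_zero
  obtain ⟨φ, hφ⟩ := exists_isReduction_of_not_dvd_disc hd
  refine idealModule_hom_ext fun a => ?_
  obtain ⟨g, ha, hloc⟩ := exists_mul_le_order p a
  rw [← cls_mul a g]
  generalize a.mul g = a at ha hloc
  have card_intermediate (c) (hc : c ∈ heckeSet (p ^ k * p * p) a) :
      ({b ∈ (heckeSet_finite p a).toFinset | c.1 ≤ b.1}).card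
        = 1 + if c.1 ≤ (a.mul (intUnit p hp0)).1 then p else 0 := by
    split_ifs with hcp
    · rw [card_intermediate_of_le_intUnit hφ ha hloc hcp, add_comm]
    · refine card_intermediate_of_not_le_intUnit hφ ha hloc hc.1 ?_ hcp
      rw [hc.2, Rat.cast_mul, norm_mul, norm_latticeNorm_of_loc_eq_order hloc, mul_one,
        Rat.cast_natCast, Padic.norm_natCast_lt_one_iff]
      exact dvd_mul_left _ _
  rw [LinearMap.sub_apply, LinearMap.smul_apply, LinearMap.comp_apply, hecke_single, hecke_single,
    hecke_single, one_smul, one_smul, one_smul, hecke_heckeClass, eq_sub_iff_add_eq,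
    ← sum_heckeSet_le_intUnit R (p ^ k) a hp0, pow_succ p (k + 1), pow_succ p k, heckeClass_cls,
    Finset.smul_sum, Finset.sum_filter, ← Finset.sum_add_distrib]
  refine Finset.sum_congr rfl fun c hc => ?_
  rw [card_intermediate c ((Set.Finite.mem_toFinset _).1 hc), add_smul, one_smul]
  split_ifs
  · rw [Nat.cast_smul_eq_nsmul]
  · rw [zero_smul]

end PrimePower

/-! ### The operators `t_m` on the real vector space -/

section HeckeReal

variable {α β : ℚ} {O : Subring ℍ[ℚ,α,β]} [IsOrder O]

theorem height_heckeReal (hα : α < 0) (hβ : β < 0) (m : ℕ) (v w : IdealModule ℝ O) :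
    height O (heckeReal O m v) w = height O v (heckeReal O m w) := by
  rw [heckeReal]
  split_ifs
  · exact height_heckeZero hα hβ v w
  · exact height_hecke hα hβ m v w

theorem heckeReal_mul_of_coprime {m m' : ℕ} (h : Nat.Coprime m m') :
    heckeReal O (m * m') = heckeReal O m ∘ₗ heckeReal O m' := by
  rcases eq_or_ne m 0 with rfl | hm
  · obtain rfl := (Nat.coprime_zero_left m').1 h
    simp [heckeReal, hecke_one]
  rcases eq_or_ne m' 0 with rfl | hm'
  · obtain rfl := (Nat.coprime_zero_right m).1 h
    simp [heckeReal, hecke_one]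
  rw [heckeReal, heckeReal, heckeReal, if_neg hm, if_neg hm', if_neg (mul_ne_zero hm hm')]
  exact hecke_mul_of_coprime ℝ h

end HeckeReal

end QuatHecke

end

open scoped Quaternion in
open QuatHecke in
theorem mainTheorem5 (α β : ℚ) (hα : α < 0) (hβ : β < 0) (O : Subring ℍ[ℚ,α,β]) [IsOrder O] :
    (∀ m : ℕ, 1 ≤ m → ∀ a : LeftIdeal O, (heckeSet m a).Finite) ∧
    (∀ m : ℕ, 1 ≤ m → ∀ v w : IdealModule ℤ O,
      height O (toReal (hecke ℤ O m v)) (toReal w) =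
        height O (toReal v) (toReal (hecke ℤ O m w))) ∧
    (∀ (m : ℕ) (v w : IdealModule ℝ O),
      height O (heckeReal O m v) w = height O v (heckeReal O m w)) ∧
    (∀ m m' : ℕ, 1 ≤ m → 1 ≤ m' → Nat.Coprime m m' →
      hecke ℤ O (m * m') = hecke ℤ O m ∘ₗ hecke ℤ O m') ∧
    (∀ m m' : ℕ, Nat.Coprime m m' →
      heckeReal O (m * m') = heckeReal O m ∘ₗ heckeReal O m') ∧
    (∀ p : ℕ, p.Prime → ¬ p ∣ disc (toLat O) → ∀ k : ℕ,
      hecke ℤ O (p ^ (k + 2)) =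
        hecke ℤ O (p ^ (k + 1)) ∘ₗ hecke ℤ O p - (p : ℤ) • hecke ℤ O (p ^ k)) := by
  refine ⟨fun m _ a => heckeSet_finite m a, fun m _ v w => ?_, height_heckeReal hα hβ,
    fun m m' _ _ h => hecke_mul_of_coprime ℤ h, fun m m' h => heckeReal_mul_of_coprime h,
    fun p hp hd k => ?_⟩
  · rw [toReal_hecke, toReal_hecke, height_hecke hα hβ]
  · have : Fact p.Prime := ⟨hp⟩
    exact hecke_prime_pow ℤ hd k
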